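/- A context-free grammar $G=(N,\Sigma,P,S)$ has finite disjoint sets $N$ of nonterminals and $\Sigma$ of terminals, a start symbol $S\in N$ and a finite set $P$ of productions $A\to\alpha$ with $A\in N$, $\alpha\in(N\cup\Sigma)^*$. Let $\Sigma$ be linearly ordered and order $\Sigma^*$ lexicographically: $u<v$ iff $u$ is a proper prefix of $v$, or $u=xay$ and $v=xbz$ with letters $a<b$. For $X\in N$ let $L(X)=\{w\in\Sigma^*: X\Rightarrow^* w\}$ and let $o(X)$ be the order type of $(L(X),<)$. The grammar $G$ is an *ordinal grammar* if, for every $X\in N$, the language $L(X)$ is prefix-free (no word of $L(X)$ is a proper prefix of another one) and well-ordered by $<$, so that $o(X)$ is an ordinal. A nonterminal $X$ is *recursive* if $X\Rightarrow^+\alpha X\beta$ for some $\alpha,\beta\in(N\cup\Sigma)^*$. An ordinal grammar is in *normal form* if - for each $X\in N$ there are $u,v,w\in\Sigma^*$ with $S\Rightarrow^* uXv$ and $X\Rightarrow^* w$; - $L(X)$ is infinite for each $X\in N$; - each production has the form $A\to a\alpha$ with $a\in\Sigma$ and $\alpha\in(N\cup\Sigma)^*$; - every nonterminal different from $S$ is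 recursive. **Theorem.** If $G$ is an ordinal grammar in normal form and $X$ is a recursive nonterminal of $G$, then $o(X)$ is computable (in Cantor normal form), uniformly in $G$ and $X$. That is, there is a single algorithm (a partial recursive function) which, given as input a finite description of any ordinal grammar $G=(N,\Sigma,P,S)$ in normal form together with any recursive nonterminal $X$ of $G$, halts and outputs the Cantor normal form $o(X)=\omega^{\alpha_1}\times n_1+\dots+\omega^{\alpha_k}\times n_k$ (with $\alpha_1>\dots>\alpha_k$ and integers $n_i>0$), the exponents being written in Cantor normal form themselves, hereditarily down to $0$. -/

import Mathlib

namespace OrdinalGrammar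

/-! ### Languages of nonterminals, ordinal grammars, normal form

Words over a linearly ordered alphabet `T` are lists; `<` on `List T` is the lexicographic order:
`u < v` iff `u` is a proper prefix of `v`, or `u = x a y`, `v = x b z` with letters `a < b`. -/

/-- The language `L(X)` of terminal words derivable from the nonterminal `X`. -/
def lang {T : Type} (G : ContextFreeGrammar T) (X : G.NT) : Set (List T) :=
  {w | G.Derives [Symbol.nonterminal X] (w.map Symbol.terminal)}

/-- No word of `L` is a proper prefix of another word of `L`. -/
def PrefixFree {T : Type} (L : Set (List T)) : Prop :=
  ∀ u ∈ L, ∀ v ∈ L, u <+: v → u = v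

/-- Every nonterminal generates a prefix-free language that is well-ordered lexicographically. -/
structure IsOrdinalGrammar {T : Type} [LinearOrder T] (G : ContextFreeGrammar T) : Prop where
  prefixFree : ∀ X : G.NT, PrefixFree (lang G X)
  wellOrdered : ∀ X : G.NT, IsWellOrder (lang G X) (fun u v => u.1 < v.1)

/-- The order type `o(X)` of `L(X)` under the lexicographic order. -/
noncomputable def IsOrdinalGrammar.orderType {T : Type} [LinearOrder T] {G : ContextFreeGrammar T}
    (hG : IsOrdinalGrammar G) (X : G.NT) : Ordinal.{0} :=
  haveI := hG.wellOrdered X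
  Ordinal.type (fun u v : lang G X => u.1 < v.1)

/-- `X ⇒⁺ α X β` for some sentential forms `α`, `β`. -/
def IsRecursive {T : Type} (G : ContextFreeGrammar T) (X : G.NT) : Prop :=
  ∃ α β : List (Symbol T G.NT),
    Relation.TransGen G.Produces [Symbol.nonterminal X] (α ++ [Symbol.nonterminal X] ++ β)

structure IsNormalForm {T : Type} (G : ContextFreeGrammar T) : Prop where
  /-- All nonterminals are usable. -/
  usable : ∀ X : G.NT,
    (∃ u v : List T, G.Derives [Symbol.nonterminal G.initial]
      (u.map Symbol.terminal ++ [Symbol.nonterminal X] ++ v.map Symbol.terminal)) ∧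
    ∃ w : List T, G.Derives [Symbol.nonterminal X] (w.map Symbol.terminal)
  infinite : ∀ X : G.NT, (lang G X).Infinite
  /-- The right-hand side of every production begins with a terminal. -/
  terminal_head : ∀ r ∈ G.rules, ∃ (a : T) (α : List (Symbol T G.NT)),
    r.output = Symbol.terminal a :: α
  recursive : ∀ X : G.NT, X ≠ G.initial → IsRecursive G X

/-! ### Grammars as inputs of algorithms -/

/-- Finite data `(N, Σ, P, S)`: the lists of nonterminals, of terminals and of productions, and the
start symbol. Symbols are written as numbers; in right-hand sides `Sum.inl` marks nonterminals and
`Sum.inr` marks terminals. -/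
abbrev GrammarCode : Type :=
  List ℕ × List ℕ × List (ℕ × List (ℕ ⊕ ℕ)) × ℕ

def codeSymbol {T N : Type} (eN : N → ℕ) (eT : T → ℕ) : Symbol T N → ℕ ⊕ ℕ
  | Symbol.nonterminal X => Sum.inl (eN X)
  | Symbol.terminal a => Sum.inr (eT a)

def codeRule {T N : Type} (eN : N → ℕ) (eT : T → ℕ) (r : ContextFreeRule T N) :
    ℕ × List (ℕ ⊕ ℕ) :=
  (eN r.input, r.output.map (codeSymbol eN eT))

/-- `c` describes `G` when the nonterminals are named by distinct numbers `eN X` and the terminals,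
in increasing order, by increasing numbers `eT a`. -/
structure IsCode {T : Type} [LinearOrder T] (G : ContextFreeGrammar T)
    (eN : G.NT → ℕ) (eT : T → ℕ) (c : GrammarCode) : Prop where
  injective : Function.Injective eN
  strictMono : StrictMono eT
  nonterminals : ∀ m : ℕ, m ∈ c.1 ↔ ∃ X : G.NT, eN X = m
  terminals : ∀ m : ℕ, m ∈ c.2.1 ↔ ∃ a : T, eT a = m
  productions : ∀ p : ℕ × List (ℕ ⊕ ℕ), p ∈ c.2.2.1 ↔ ∃ r ∈ G.rules, codeRule eN eT r = p
  start : c.2.2.2 = eN G.initial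

/-! ### Cantor normal forms as outputs of algorithms

`ONote` is the type of terms built from `0` and `(e, n, a) ↦ ω ^ e * n + a`, `ONote.NF` says that
such a term is a Cantor normal form (hereditarily), and `ONote.repr` is its value. Terms are
identified with numbers in the usual recursive way. -/

def onoteToNat : ONote → ℕ
  | ONote.zero => 0
  | ONote.oadd e n a => Nat.pair (onoteToNat e) (Nat.pair n.natPred (onoteToNat a)) + 1

def onoteOfNat : ℕ → ONote
  | 0 => ONote.zero
  | k + 1 =>
    have _h₁ : k.unpair.1 < k + 1 := Nat.lt_succ_of_le (Nat.unpair_left_le k)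
    have _h₂ : k.unpair.2.unpair.2 < k + 1 :=
      Nat.lt_succ_of_le ((Nat.unpair_right_le _).trans (Nat.unpair_right_le k))
    ONote.oadd (onoteOfNat k.unpair.1) k.unpair.2.unpair.1.succPNat
      (onoteOfNat k.unpair.2.unpair.2)

theorem onoteOfNat_toNat (x : ONote) : onoteOfNat (onoteToNat x) = x := by
  induction x with
  | zero => simp [onoteToNat, onoteOfNat]
  | oadd e n a ihe iha => simp [onoteToNat, onoteOfNat, ihe, iha]

theorem onoteToNat_ofNat (m : ℕ) : onoteToNat (onoteOfNat m) = m := by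
  induction m using Nat.strong_induction_on with
  | _ m ih =>
    cases m with
    | zero => simp [onoteToNat, onoteOfNat]
    | succ k =>
      have h₁ := ih k.unpair.1 (Nat.lt_succ_of_le (Nat.unpair_left_le k))
      have h₂ := ih k.unpair.2.unpair.2
        (Nat.lt_succ_of_le ((Nat.unpair_right_le _).trans (Nat.unpair_right_le k)))
      simp [onoteToNat, onoteOfNat, h₁, h₂]

def onoteEquivNat : ONote ≃ ℕ :=
  ⟨onoteToNat, onoteOfNat, onoteOfNat_toNat, onoteToNat_ofNat⟩

instance instPrimcodableONote : Primcodable ONote :=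
  Primcodable.ofEquiv ℕ onoteEquivNat

end OrdinalGrammar

namespace OrdinalGrammar

/-! ### Words -/

section Words

variable {T : Type}

/-! In a production X → vYδ no nonterminal of δ leads back to X, for otherwise o(X)·ω ≤ o(X)
(`not_reach_of_mem_tail`). So all recursion runs through leading nonterminals. If u ≠ ε is a loop of
X, meaning uL(X)z ⊆ L(X) for some z, then L(X) lies strictly below the infinite word uuu⋯
(`Context.exists_strictLex_wordPow`), since a larger word would start an infinite descent and a
prefix would violate prefix-freeness.

Fix loops U of one common length for the recursive nonterminals. For X → vYδ there are two cases. If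
U X · v = v · U Y, the words of the production approach the infinite word that bounds L(X).
Otherwise they all stay below some power of U X, and the production is called bounded; this forces Y
to be strictly lower than X in the reachability order.

The order types turn out to be powers ω^a(X). A production with nonterminals X₁⋯Xₖ contributes
a(Xₖ)+⋯+a(X₁) to the exponent, since the leftmost factor is compared first. A bounded production
contributes 1 more, because the loop of X stacks ω copies of it (`typeGE_ruleExponent`). If Y leads
back to X and δ contains some Z of type at least ω^d, then ω^d·o(X) = o(X), and hence ω^(d·ω)
divides o(X) (`typeGE_of_loop`). Conversely, every solution of the inequalities "contribution ≤
a(X)" with nonzero exponents bounds the order types from above (`typeLE_lang_of_ruleExponent_le`).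
The words of L(X) below a given power of U X form a finite union of pieces shorter than ω^a(X), and
natural sums keep the union shorter.

The exponents are below ω^ω, so they are finite lists of natural numbers. A certificate records
loops, exponents, and reasons for both bounds. Its validity is primitive recursive, a valid one
determines o(X) (`Certificate.Valid.orderType_eq`), and one always exists
(`Certificate.exists_valid`). The algorithm searches for a valid certificate. -/

theorem PrefixFree.eq_of_append_eq {A : Set (List T)} (hA : PrefixFree A) {x x' y y' : List T}
    (hx : x ∈ A) (hx' : x' ∈ A) (h : x ++ y = x' ++ y') : x = x' ∧ y = y' := by
  have : x = x' := by
    rcases List.prefix_or_prefix_of_prefix (l₃ := x ++ y) (List.prefix_append x y)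
      (h ▸ List.prefix_append x' y') with h' | h'
    · exact hA _ hx _ hx' h'
    · exact (hA _ hx' _ hx h').symm
  subst this
  exact ⟨rfl, List.append_cancel_left h⟩

/-- `u` repeated `n` times. -/
def wordPow (u : List T) : ℕ → List T
  | 0 => []
  | n + 1 => u ++ wordPow u n

theorem wordPow_add (u : List T) (m n : ℕ) :
    wordPow u (m + n) = wordPow u m ++ wordPow u n := by
  induction m with
  | zero => simp [wordPow]
  | succ m ih => rw [Nat.succ_add]; simp [wordPow, ih]

theorem wordPow_one (u : List T) : wordPow u 1 = u := by simp [wordPow]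

theorem length_wordPow (u : List T) (n : ℕ) : (wordPow u n).length = n * u.length := by
  induction n with
  | zero => simp [wordPow]
  | succ n ih => simp [wordPow, ih]; ring

theorem wordPow_prefix (u : List T) {m n : ℕ} (h : m ≤ n) : wordPow u m <+: wordPow u n := by
  obtain ⟨k, rfl⟩ := Nat.exists_eq_add_of_le h
  rw [wordPow_add]
  exact List.prefix_append _ _

theorem append_wordPow_of_comm {u v t : List T} (h : u ++ v = v ++ t) (n : ℕ) :
    wordPow u n ++ v = v ++ wordPow t n := by
  induction n with
  | zero => simp [wordPow]
  | succ n ih => simp only [wordPow, List.append_assoc]; rw [ih, ← List.append_assoc, h]; simp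

end Words

/-! ### Strict lexicographic comparison -/

section Words

variable {T : Type} [LinearOrder T]

/-- `u` is smaller than `v` at the first position where the two words differ. -/
def StrictLex : List T → List T → Prop
  | a :: u, b :: v => a < b ∨ a = b ∧ StrictLex u v
  | _, _ => False

@[simp] theorem strictLex_nil_left (v : List T) : ¬ StrictLex [] v := by simp [StrictLex]

@[simp] theorem strictLex_nil_right (u : List T) : ¬ StrictLex u [] := by
  cases u <;> simp [StrictLex]

@[simp] theorem strictLex_cons {a b : T} {u v : List T} :
    StrictLex (a :: u) (b :: v) ↔ a < b ∨ a = b ∧ StrictLex u v := by simp [StrictLex]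

@[simp] theorem strictLex_append_left (x u v : List T) :
    StrictLex (x ++ u) (x ++ v) ↔ StrictLex u v := by
  induction x with
  | nil => simp
  | cons a x ih => simp [ih]

/-- The reason for working with `StrictLex` instead of `<`: a comparison decided at a differing
letter survives arbitrary tails, whereas a comparison between a word and its proper prefix does not.
-/
theorem StrictLex.append {u v : List T} (h : StrictLex u v) (c d : List T) :
    StrictLex (u ++ c) (v ++ d) := by
  induction u generalizing v with
  | nil => simp at h
  | cons a u ih =>
    cases v with
    | nil => simp at h
    | cons b v =>
      simp only [strictLex_cons, List.cons_append] at h ⊢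
      exact h.imp_right fun h => ⟨h.1, ih h.2⟩

theorem StrictLex.append_left {u v : List T} (h : StrictLex u v) (c : List T) :
    StrictLex (u ++ c) v := by simpa using h.append c []

theorem StrictLex.append_right {u v : List T} (h : StrictLex u v) (d : List T) :
    StrictLex u (v ++ d) := by simpa using h.append [] d

theorem StrictLex.trans {u v w : List T} (h : StrictLex u v) (h' : StrictLex v w) :
    StrictLex u w := by
  induction u generalizing v w with
  | nil => simp at h
  | cons a u ih =>
    cases v with
    | nil => simp at h
    | cons b v =>
      cases w with
      | nil => simp at h'
      | cons c w =>
        simp only [strictLex_cons] at h h' ⊢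
        rcases h with h | ⟨rfl, h⟩ <;> rcases h' with h' | ⟨rfl, h'⟩
        · exact Or.inl (h.trans h')
        · exact Or.inl h
        · exact Or.inl h'
        · exact Or.inr ⟨rfl, ih h h'⟩

theorem StrictLex.not_prefix {u v : List T} (h : StrictLex u v) : ¬ u <+: v := by
  induction u generalizing v with
  | nil => simp at h
  | cons a u ih =>
    cases v with
    | nil => simp
    | cons b v =>
      rw [List.cons_prefix_cons]
      rintro ⟨rfl, h'⟩
      simp only [strictLex_cons, lt_irrefl, true_and, false_or] at h
      exact ih h h'

theorem StrictLex.not_prefix' {u v : List T} (h : StrictLex u v) : ¬ v <+: u := by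
  induction u generalizing v with
  | nil => simp at h
  | cons a u ih =>
    cases v with
    | nil => simp at h
    | cons b v =>
      rw [List.cons_prefix_cons]
      rintro ⟨rfl, h'⟩
      simp only [strictLex_cons, lt_irrefl, true_and, false_or] at h
      exact ih h h'

theorem strictLex_irrefl (u : List T) : ¬ StrictLex u u := fun h => h.not_prefix List.prefix_rfl

theorem StrictLex.asymm {u v : List T} (h : StrictLex u v) : ¬ StrictLex v u :=
  fun h' => strictLex_irrefl u (h.trans h')

theorem StrictLex.of_prefix_right {u v w : List T} (h : StrictLex u v) (hvw : v <+: w) :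
    StrictLex u w := by
  obtain ⟨d, rfl⟩ := hvw
  exact h.append_right d

theorem strictLex_trichotomy (u v : List T) :
    StrictLex u v ∨ StrictLex v u ∨ u <+: v ∨ v <+: u := by
  induction u generalizing v with
  | nil => simp
  | cons a u ih =>
    cases v with
    | nil => simp
    | cons b v =>
      simp only [strictLex_cons, List.cons_prefix_cons]
      rcases lt_trichotomy a b with h | rfl | h
      · simp [h]
      · simpa using ih v
      · simp [h]

theorem lt_iff_strictLex_or_prefix (u v : List T) :
    u < v ↔ StrictLex u v ∨ (u <+: v ∧ u ≠ v) := by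
  induction u generalizing v with
  | nil => cases v <;> simp
  | cons a u ih =>
    cases v with
    | nil => simp
    | cons b v =>
      rw [List.cons_lt_cons_iff, ih]
      simp only [strictLex_cons, List.cons_prefix_cons, ne_eq, List.cons.injEq]
      tauto

theorem StrictLex.lt {u v : List T} (h : StrictLex u v) : u < v :=
  (lt_iff_strictLex_or_prefix u v).2 (Or.inl h)

theorem PrefixFree.strictLex {A : Set (List T)} (hA : PrefixFree A) {u v : List T} (hu : u ∈ A)
    (hv : v ∈ A) (h : u < v) : StrictLex u v := by
  rcases (lt_iff_strictLex_or_prefix u v).1 h with h | ⟨h, hne⟩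
  · exact h
  · exact absurd (hA u hu v hv h) hne

theorem not_strictLex_wordPow (u : List T) (m n : ℕ) : ¬ StrictLex (wordPow u m) (wordPow u n) := by
  intro h
  rcases le_total m n with h' | h'
  · exact h.not_prefix (wordPow_prefix u h')
  · exact h.not_prefix' (wordPow_prefix u h')

end Words

/-! ### Bounds on order types -/

section OrderTypes

open Ordinal

variable {T : Type} [LinearOrder T]

/-- The order type of `A` is at most `o`. -/
def TypeLE (A : Set (List T)) (o : Ordinal.{0}) : Prop :=
  ∃ f : List T → Ordinal.{0}, (∀ x ∈ A, f x < o) ∧ ∀ x ∈ A, ∀ y ∈ A, x < y → f x < f y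

/-- `A` contains a copy of `o`. -/
def TypeGE (A : Set (List T)) (o : Ordinal.{0}) : Prop :=
  ∃ f : Ordinal.{0} → List T, (∀ c < o, f c ∈ A) ∧ ∀ c d, c < d → d < o → f c < f d

theorem TypeLE.mono {A B : Set (List T)} {a b : Ordinal} (h : TypeLE A a) (hB : B ⊆ A)
    (hab : a ≤ b) : TypeLE B b := by
  obtain ⟨f, h1, h2⟩ := h
  exact ⟨f, fun x hx => (h1 x (hB hx)).trans_le hab, fun x hx y hy => h2 x (hB hx) y (hB hy)⟩

theorem TypeGE.mono {A B : Set (List T)} {a b : Ordinal} (h : TypeGE A a) (hB : A ⊆ B)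
    (hab : b ≤ a) : TypeGE B b := by
  obtain ⟨f, h1, h2⟩ := h
  exact ⟨f, fun c hc => hB (h1 c (hc.trans_le hab)), fun c d h hd => h2 c d h (hd.trans_le hab)⟩

/-- The composite of the two maps is strictly increasing on the ordinals below `a`, so it never
falls below the identity. -/
theorem TypeGE.le {A : Set (List T)} {a b : Ordinal} (h : TypeGE A a) (h' : TypeLE A b) :
    a ≤ b := by
  obtain ⟨g, g1, g2⟩ := h
  obtain ⟨f, f1, f2⟩ := h'
  by_contra! hlt
  have key : ∀ c : Ordinal, c < a → c ≤ f (g c) := by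
    intro c
    induction c using WellFoundedLT.induction with
    | _ c ih =>
      intro hc
      by_contra! hlt'
      have h1 := ih _ hlt' (hlt'.trans hc)
      have h2 := f2 _ (g1 _ (hlt'.trans hc)) _ (g1 _ hc) (g2 _ _ hlt' hc)
      exact absurd h2 (not_lt.2 h1)
  exact absurd (f1 _ (g1 b hlt)) (not_lt.2 (key b hlt))

theorem TypeLE.image_append {A : Set (List T)} {a : Ordinal} (h : TypeLE A a) (v : List T) :
    TypeLE ((v ++ ·) '' A) a := by
  obtain ⟨f, f1, f2⟩ := h
  refine ⟨fun w => f (w.drop v.length), ?_, ?_⟩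
  · rintro _ ⟨x, hx, rfl⟩
    simpa using f1 x hx
  · rintro _ ⟨x, hx, rfl⟩ _ ⟨y, hy, rfl⟩ hxy
    simp only [List.drop_left]
    refine f2 x hx y hy ?_
    rw [lt_iff_strictLex_or_prefix] at hxy ⊢
    simpa using hxy

/-- If appending fixed words on both sides maps `B` into `A`, then `A` is at least as long. -/
theorem TypeGE.of_context {A B : Set (List T)} {b : Ordinal} (h : TypeGE B b)
    (hB : PrefixFree B) (u z : List T) (hu : ∀ w ∈ B, u ++ w ++ z ∈ A) : TypeGE A b := by
  obtain ⟨f, f1, f2⟩ := h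
  refine ⟨fun c => u ++ f c ++ z, fun c hc => hu _ (f1 c hc), fun c d hcd hd => ?_⟩
  refine StrictLex.lt ?_
  refine StrictLex.append ?_ _ _
  simpa using hB.strictLex (f1 _ (hcd.trans hd)) (f1 _ hd) (f2 c d hcd hd)

/-- Prefix-freeness of `A` makes the factorization unique and lets the first factor decide the
order. The second factor varies fastest, which explains the reversed product `b * a`. -/
theorem TypeLE.image2_append {A B : Set (List T)} {a b : Ordinal} (hA : PrefixFree A)
    (h : TypeLE A a) (h' : TypeLE B b) : TypeLE (Set.image2 (· ++ ·) A B) (b * a) := by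
  classical
  obtain ⟨f, f1, f2⟩ := h
  obtain ⟨g, g1, g2⟩ := h'
  -- Any choice of factorization is the only one; outside the product set the value 0 is irrelevant.
  let F : List T → Ordinal := fun w =>
    if hw : ∃ p : List T × List T, p.1 ∈ A ∧ p.2 ∈ B ∧ p.1 ++ p.2 = w then
      b * f hw.choose.1 + g hw.choose.2 else 0
  have hF : ∀ x ∈ A, ∀ y ∈ B, F (x ++ y) = b * f x + g y := by
    intro x hx y hy
    have hw : ∃ p : List T × List T, p.1 ∈ A ∧ p.2 ∈ B ∧ p.1 ++ p.2 = x ++ y :=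
      ⟨(x, y), hx, hy, rfl⟩
    have e := hA.eq_of_append_eq hw.choose_spec.1 hx hw.choose_spec.2.2
    simp only [F, dif_pos hw, e.1, e.2]
  refine ⟨F, ?_, ?_⟩
  · rintro _ ⟨x, hx, y, hy, rfl⟩
    simp only [hF x hx y hy]
    calc b * f x + g y < b * f x + b := by gcongr; exact g1 y hy
      _ = b * (f x + 1) := by rw [mul_add_one]
      _ ≤ b * a := by gcongr; exact Order.add_one_le_of_lt (f1 x hx)
  · rintro _ ⟨x, hx, y, hy, rfl⟩ _ ⟨x', hx', y', hy', rfl⟩ hlt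
    simp only [hF x hx y hy, hF x' hx' y' hy']
    rcases lt_trichotomy x x' with h | rfl | h
    · calc b * f x + g y < b * f x + b := by gcongr; exact g1 y hy
        _ = b * (f x + 1) := by rw [mul_add_one]
        _ ≤ b * f x' := by gcongr; exact Order.add_one_le_of_lt (f2 x hx x' hx' h)
        _ ≤ _ := le_self_add
    · gcongr
      refine g2 y hy y' hy' ?_
      rw [lt_iff_strictLex_or_prefix] at hlt ⊢
      simpa using hlt
    · exact absurd hlt ((hA.strictLex hx' hx h).append y' y).lt.asymm

theorem TypeGE.image2_append {A B : Set (List T)} {a b : Ordinal} (hA : PrefixFree A)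
    (h : TypeGE A a) (h' : TypeGE B b) : TypeGE (Set.image2 (· ++ ·) A B) (b * a) := by
  obtain ⟨f, f1, f2⟩ := h
  obtain ⟨g, g1, g2⟩ := h'
  have hb : ∀ c < b * a, b ≠ 0 := by rintro c hc rfl; simp at hc
  have hd : ∀ c < b * a, c / b < a := fun c hc => (lt_mul_iff_div_lt (hb c hc)).1 hc
  have hm : ∀ c < b * a, c % b < b := fun c hc => mod_lt c (hb c hc)
  -- The quotient selects the first factor and the remainder the second, inverting `b * x + y`.
  refine ⟨fun c => f (c / b) ++ g (c % b), fun c hc => ?_, fun c d hcd hd' => ?_⟩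
  · exact ⟨_, f1 _ (hd c hc), _, g1 _ (hm c hc), rfl⟩
  · have hc := hcd.trans hd'
    have hle : c / b ≤ d / b := by
      rw [← mul_le_iff_le_div (hb c hc)]
      exact (Ordinal.mul_div_le c b).trans hcd.le
    rcases hle.lt_or_eq with h | h
    · exact ((hA.strictLex (f1 _ (hd c hc)) (f1 _ (hd d hd')) (f2 _ _ h (hd d hd'))).append _ _).lt
    · have : c % b < d % b := by
        have h1 := Ordinal.div_add_mod c b
        have h2 := Ordinal.div_add_mod d b
        rw [← h1, ← h2, h] at hcd
        exact lt_of_add_lt_add_left hcd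
      have := g2 _ _ this (hm d hd')
      simp only [h]
      rw [lt_iff_strictLex_or_prefix] at this ⊢
      simpa using this

end OrderTypes

/-! ### The natural sum -/

section NaturalSum

open Ordinal

/-- Ensures that both remainders modulo the leading power are smaller than `max a b`, which makes
the recursion of `naturalSum` terminate. -/
theorem opow_max_log_le {a b : Ordinal} (h : max a b ≠ 0) :
    ω ^ max (log ω a) (log ω b) ≤ max a b := by
  rcases max_cases (log ω a) (log ω b) with ⟨e, h'⟩ | ⟨e, h'⟩ <;> rw [e]
  · rcases eq_or_ne a 0 with rfl | ha
    · have : b ≠ 0 := by simpa using h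
      simp only [log_zero_right, opow_zero]
      exact (Order.one_le_iff_ne_zero.2 this).trans (le_max_right _ _)
    · exact (opow_log_le_self _ ha).trans (le_max_left _ _)
  · refine (opow_log_le_self _ ?_).trans (le_max_right _ _)
    rintro rfl
    simp at h'

/-- The natural sum of two ordinals, computed from the leading terms of their normal forms. -/
noncomputable def naturalSum (a b : Ordinal.{0}) : Ordinal.{0} :=
  if h : max a b = 0 then 0 else
    ω ^ max (log ω a) (log ω b) *
        (a / ω ^ max (log ω a) (log ω b) + b / ω ^ max (log ω a) (log ω b)) +
      naturalSum (a % ω ^ max (log ω a) (log ω b)) (b % ω ^ max (log ω a) (log ω b))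
termination_by max a b
decreasing_by
  have h0 : ω ^ max (log ω a) (log ω b) ≠ 0 := (opow_pos _ omega0_pos).ne'
  exact (max_lt (mod_lt a h0) (mod_lt b h0)).trans_le (opow_max_log_le h)

theorem log_max_lt {a b e : Ordinal} (h : max a b ≠ 0) (ha : a < ω ^ e) (hb : b < ω ^ e) :
    max (log ω a) (log ω b) < e := by
  have h0 : e ≠ 0 := by
    rintro rfl
    simp only [opow_zero, Order.lt_one_iff] at ha hb
    simp [ha, hb] at h
  have key : ∀ c < ω ^ e, log ω c < e := by
    intro c hc
    rcases eq_or_ne c 0 with rfl | hc0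
    · simpa using pos_iff_ne_zero.2 h0
    · exact (lt_opow_iff_log_lt one_lt_omega0 hc0).1 hc
  exact max_lt (key a ha) (key b hb)

theorem div_opow_max_log_lt (a b : Ordinal) :
    a / ω ^ max (log ω a) (log ω b) < ω ∧ b / ω ^ max (log ω a) (log ω b) < ω := by
  have h0 : ω ^ max (log ω a) (log ω b) ≠ 0 := (opow_pos _ omega0_pos).ne'
  have key : ∀ c e : Ordinal, log ω c ≤ e → c / ω ^ e < ω := by
    intro c e h
    rw [← lt_mul_iff_div_lt (opow_pos _ omega0_pos).ne', ← opow_succ]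
    refine (lt_opow_succ_log_self one_lt_omega0 c).trans_le ?_
    exact opow_le_opow_right omega0_pos (Order.succ_le_succ h)
  exact ⟨key _ _ (le_max_left _ _), key _ _ (le_max_right _ _)⟩

/-- The leading digits are finite, so their sum stays below ω, and the recursive remainder stays
below the leading power by induction on the exponent. -/
theorem naturalSum_lt (e : Ordinal) : ∀ a b : Ordinal, a < ω ^ e → b < ω ^ e →
    naturalSum a b < ω ^ e := by
  induction e using WellFoundedLT.induction with
  | _ e ih =>
    intro a b ha hb
    rw [naturalSum]
    split_ifs with h
    · exact opow_pos _ omega0_pos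
    · have he := log_max_lt h ha hb
      have hd := div_opow_max_log_lt a b
      set m := max (log ω a) (log ω b)
      have h0 : ω ^ m ≠ 0 := (opow_pos _ omega0_pos).ne'
      calc _ < ω ^ m * (a / ω ^ m + b / ω ^ m) + ω ^ m := by
            gcongr
            exact ih m he _ _ (mod_lt a h0) (mod_lt b h0)
        _ = ω ^ m * (a / ω ^ m + b / ω ^ m + 1) := by rw [mul_add_one]
        _ ≤ ω ^ m * ω := by
            gcongr
            exact (isPrincipal_add_omega0 (isPrincipal_add_omega0 hd.1 hd.2) one_lt_omega0).le
        _ = ω ^ (Order.succ m) := by rw [opow_succ]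
        _ ≤ ω ^ e := opow_le_opow_right omega0_pos (Order.succ_le_of_lt he)

theorem le_naturalSum {a b : Ordinal} (h : max a b ≠ 0) :
    ω ^ max (log ω a) (log ω b) ≤ naturalSum a b := by
  have h0 : ω ^ max (log ω a) (log ω b) ≠ 0 := (opow_pos _ omega0_pos).ne'
  rw [naturalSum, dif_neg h]
  refine le_trans ?_ le_self_add
  refine le_mul_of_one_le_right' ?_
  have key : ∀ c : Ordinal, c ≠ 0 → 1 ≤ c / ω ^ log ω c := by
    intro c hc
    rw [← mul_le_iff_le_div (opow_pos _ omega0_pos).ne', mul_one]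
    exact opow_log_le_self _ hc
  rcases max_cases (log ω a) (log ω b) with ⟨e, h'⟩ | ⟨e, h'⟩ <;> rw [e]
  · rcases eq_or_ne a 0 with rfl | ha
    · have : b ≠ 0 := by simpa using h
      simpa using Order.one_le_iff_ne_zero.2 this
    · exact (key a ha).trans le_self_add
  · refine (key b ?_).trans le_add_self
    rintro rfl
    simp at h'

/-- Strict monotonicity in each argument is what ordinary addition lacks on the left. If the leading
exponent grows, closure of powers of ω suffices. If it stays and a leading digit grows, one more
multiple of the leading power outweighs the remainders. If all leading digits agree, the comparison
passes to the remainders. -/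
theorem naturalSum_lt_naturalSum : ∀ a' b' a b : Ordinal, a ≤ a' → b ≤ b' → (a < a' ∨ b < b') →
    naturalSum a b < naturalSum a' b' := by
  intro a' b'
  induction hn : max a' b' using WellFoundedLT.induction generalizing a' b' with
  | _ n ih =>
    subst hn
    intro a b ha hb hlt
    have h' : max a' b' ≠ 0 := by
      rcases hlt with h | h
      · exact ((zero_le.trans_lt h).trans_le (le_max_left _ _)).ne'
      · exact ((zero_le.trans_lt h).trans_le (le_max_right _ _)).ne'
    by_cases h : max a b = 0
    · rw [naturalSum, dif_pos h]
      exact (opow_pos _ omega0_pos).trans_le (le_naturalSum h')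
    have hm : max (log ω a) (log ω b) ≤ max (log ω a') (log ω b') :=
      max_le_max (log_mono_right _ ha) (log_mono_right _ hb)
    rcases hm.lt_or_eq with hm | hm
    · refine lt_of_lt_of_le ?_ (le_naturalSum h')
      have key : ∀ c e : Ordinal, log ω c < e → c < ω ^ e := fun c e hc =>
        (lt_opow_succ_log_self one_lt_omega0 c).trans_le
          (opow_le_opow_right omega0_pos (Order.succ_le_of_lt hc))
      exact naturalSum_lt _ _ _ (key _ _ ((le_max_left _ _).trans_lt hm))
        (key _ _ ((le_max_right _ _).trans_lt hm))
    · have hd := div_opow_max_log_lt a' b'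
      conv_lhs => rw [naturalSum, dif_neg h, hm]
      conv_rhs => rw [naturalSum, dif_neg h']
      have hpos := opow_max_log_le h'
      have hb' := naturalSum_lt (max (log ω a) (log ω b))
      rw [hm] at hb'
      set m := max (log ω a') (log ω b')
      have h0 : ω ^ m ≠ 0 := (opow_pos _ omega0_pos).ne'
      have hq : ∀ c c' : Ordinal, c ≤ c' → c / ω ^ m ≤ c' / ω ^ m := fun c c' hc => by
        rw [← mul_le_iff_le_div h0]
        exact (mul_div_le c _).trans hc
      have hqr : ∀ c c' : Ordinal, c / ω ^ m = c' / ω ^ m → c < c' → c % ω ^ m < c' % ω ^ m :=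
        fun c c' e hc => by
          have h1 := div_add_mod c (ω ^ m)
          have h2 := div_add_mod c' (ω ^ m)
          rw [← h1, ← h2, e] at hc
          exact lt_of_add_lt_add_left hc
      by_cases hdig : a / ω ^ m = a' / ω ^ m ∧ b / ω ^ m = b' / ω ^ m
      · rw [hdig.1, hdig.2]
        gcongr
        refine ih _ (lt_of_lt_of_le (max_lt (mod_lt a' h0) (mod_lt b' h0)) hpos) _ _ rfl _ _
          ?_ ?_ ?_
        · rcases ha.lt_or_eq with h1 | h1
          · exact (hqr _ _ hdig.1 h1).le
          · rw [h1]
        · rcases hb.lt_or_eq with h1 | h1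
          · exact (hqr _ _ hdig.2 h1).le
          · rw [h1]
        · exact hlt.imp (hqr _ _ hdig.1) (hqr _ _ hdig.2)
      · have hs : a / ω ^ m + b / ω ^ m < a' / ω ^ m + b' / ω ^ m := by
          have e1 := hq a a' ha
          have e2 := hq b b' hb
          obtain ⟨i', hi'⟩ := lt_omega0.1 hd.1
          obtain ⟨j', hj'⟩ := lt_omega0.1 hd.2
          obtain ⟨i, hi⟩ := lt_omega0.1 (e1.trans_lt hd.1)
          obtain ⟨j, hj⟩ := lt_omega0.1 (e2.trans_lt hd.2)
          rw [hi, hi', hj, hj'] at hdig ⊢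
          rw [hi, hi'] at e1
          rw [hj, hj'] at e2
          norm_cast at e1 e2 hdig ⊢
          omega
        calc _ < ω ^ m * (a / ω ^ m + b / ω ^ m) + ω ^ m := by
              gcongr
              exact hb' _ _ (mod_lt a h0) (mod_lt b h0)
          _ = ω ^ m * (a / ω ^ m + b / ω ^ m + 1) := by rw [mul_add_one]
          _ ≤ ω ^ m * (a' / ω ^ m + b' / ω ^ m) := by
              gcongr ω ^ m * ?_
              exact Order.add_one_le_of_lt hs
          _ ≤ _ := le_self_add

theorem naturalSum_le_naturalSum {a b a' b' : Ordinal} (ha : a ≤ a') (hb : b ≤ b') :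
    naturalSum a b ≤ naturalSum a' b' := by
  by_cases h : a < a' ∨ b < b'
  · exact (naturalSum_lt_naturalSum _ _ _ _ ha hb h).le
  · rw [not_or, not_lt, not_lt] at h
    rw [le_antisymm ha h.1, le_antisymm hb h.2]

end NaturalSum

/-! ### Order types below a power of ω -/

section OrderTypes

open Ordinal

variable {T : Type} [LinearOrder T]

/-- The order type of `A` is less than `ω ^ e`. -/
def TypeSmall (A : Set (List T)) (e : Ordinal.{0}) : Prop := ∃ o < ω ^ e, TypeLE A o

theorem TypeSmall.mono {A B : Set (List T)} {e : Ordinal} (h : TypeSmall A e) (hB : B ⊆ A) :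
    TypeSmall B e := by
  obtain ⟨o, ho, h⟩ := h
  exact ⟨o, ho, h.mono hB le_rfl⟩

theorem typeLE_empty (o : Ordinal) : TypeLE (∅ : Set (List T)) o := ⟨fun _ => 0, by simp, by simp⟩

theorem typeSmall_empty (e : Ordinal) : TypeSmall (∅ : Set (List T)) e :=
  ⟨0, opow_pos _ omega0_pos, typeLE_empty 0⟩

theorem typeLE_singleton (w : List T) : TypeLE ({w} : Set (List T)) 1 := by
  refine ⟨fun _ => 0, by simp, ?_⟩
  rintro x rfl y rfl h
  exact absurd h (lt_irrefl _)

/-- `t x` measures the part of `A` below `x`, for words outside `A` too. It increases weakly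
everywhere and strictly when a member of `A` is passed, so that such measures for two sets can be
combined on their union. -/
theorem TypeLE.exists_initial {A : Set (List T)} {a : Ordinal} (h : TypeLE A a) :
    ∃ t : List T → Ordinal.{0}, (∀ x, t x ≤ a) ∧ (∀ x y, x ≤ y → t x ≤ t y) ∧
      ∀ x ∈ A, ∀ y, x < y → t x < t y := by
  obtain ⟨f, f1, f2⟩ := h
  have hne : ∀ x, a ∈ {o : Ordinal | ∀ y ∈ A, y < x → f y < o} := fun x y hy _ => f1 y hy
  have hle : ∀ x o, (∀ y ∈ A, y < x → f y < o) → sInf {o : Ordinal | ∀ y ∈ A, y < x → f y < o} ≤ o :=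
    fun x o h => csInf_le' h
  have hmem : ∀ x, ∀ y ∈ A, y < x → f y < sInf {o : Ordinal | ∀ y ∈ A, y < x → f y < o} :=
    fun x => csInf_mem ⟨a, hne x⟩
  refine ⟨fun x => sInf {o : Ordinal | ∀ y ∈ A, y < x → f y < o}, fun x => hle x a (hne x),
    fun x y hxy => hle x _ fun z hz hzx => hmem y z hz (hzx.trans_le hxy), fun x hx y hxy => ?_⟩
  exact (hle x (f x) fun z hz hzx => f2 z hz x hx hzx).trans_lt (hmem y x hx hxy)

/-- Each word is ranked by the natural sum of its positions relative to `A` and to `B`; moving up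
from a member of either set raises one summand strictly. The bound carries `+ 1` because a word
above all of `A` may attain the value `a`, and `e ≠ 0` leaves room for it. -/
theorem TypeSmall.union {A B : Set (List T)} {e : Ordinal} (he : e ≠ 0) (h : TypeSmall A e)
    (h' : TypeSmall B e) : TypeSmall (A ∪ B) e := by
  obtain ⟨a, ha, hA⟩ := h
  obtain ⟨b, hb, hB⟩ := h'
  obtain ⟨s, s1, s2, s3⟩ := hA.exists_initial
  obtain ⟨t, t1, t2, t3⟩ := hB.exists_initial
  refine ⟨naturalSum a b + 1, ?_, fun x => naturalSum (s x) (t x), fun x _ => ?_, fun x hx y _ h => ?_⟩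
  · exact isPrincipal_add_omega0_opow e (naturalSum_lt _ _ _ ha hb) (one_lt_opow.2 ⟨one_lt_omega0, he⟩)
  · exact Order.lt_add_one_iff.2 (naturalSum_le_naturalSum (s1 x) (t1 x))
  · refine naturalSum_lt_naturalSum _ _ _ _ (s2 _ _ h.le) (t2 _ _ h.le) ?_
    exact hx.imp (fun hx => s3 x hx y h) (fun hx => t3 x hx y h)

theorem TypeSmall.biUnion {ι : Type*} (s : Finset ι) (A : ι → Set (List T)) {e : Ordinal}
    (he : e ≠ 0) (h : ∀ i ∈ s, TypeSmall (A i) e) : TypeSmall (⋃ i ∈ s, A i) e := by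
  classical
  induction s using Finset.induction_on with
  | empty => simpa using typeSmall_empty e
  | insert i s _ ih =>
    rw [Finset.set_biUnion_insert]
    exact (h i (by simp)).union he (ih fun j hj => h j (by simp [hj]))

/-- If `o` were finite, the order-preserving map would embed `A` into finitely many values. -/
theorem typeGE_omega0_of_infinite {A : Set (List T)} {o : Ordinal} (h : TypeLE A o)
    (h' : TypeGE A o) (hA : A.Infinite) : TypeGE A ω := by
  refine h'.mono subset_rfl ?_
  by_contra! hlt
  obtain ⟨n, rfl⟩ := lt_omega0.1 hlt
  obtain ⟨f, f1, f2⟩ := h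
  refine hA (Set.Finite.of_finite_image (f := f) ?_ ?_)
  · refine Set.Finite.subset ((Set.finite_Iio n).image (fun k : ℕ => (k : Ordinal))) ?_
    rintro _ ⟨x, hx, rfl⟩
    have := f1 x hx
    obtain ⟨k, hk⟩ := lt_omega0.1 (this.trans hlt)
    exact ⟨k, by simpa [hk] using this, hk.symm⟩
  · intro x hx y hy hxy
    by_contra hne
    rcases lt_or_gt_of_ne hne with h | h
    · exact absurd hxy (f2 x hx y hy h).ne
    · exact absurd hxy (f2 y hy x hx h).ne'

/-- A set of words all of whose bounded initial parts are shorter than `ω ^ e` has type at most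
`ω ^ e`. -/
theorem typeLE_of_typeSmall {A : Set (List T)} (hA : PrefixFree A) {o e : Ordinal} (h : TypeLE A o)
    (h' : TypeGE A o)
    (hs : ∀ w ∈ A, TypeSmall {x ∈ A | StrictLex x w} e) : TypeLE A (ω ^ e) := by
  refine h.mono subset_rfl ?_
  by_contra! hlt
  obtain ⟨g, g1, g2⟩ := h'
  -- The member of `A` at position `ω ^ e` would have an initial part containing a copy of `ω ^ e`.
  obtain ⟨b, hb, hsm⟩ := hs _ (g1 _ hlt)
  have : TypeGE {x ∈ A | StrictLex x (g (ω ^ e))} (ω ^ e) :=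
    ⟨g, fun c hc => ⟨g1 c (hc.trans hlt), hA.strictLex (g1 c (hc.trans hlt)) (g1 _ hlt) (g2 c _ hc hlt)⟩,
      fun c d hcd hd => g2 c d hcd (hd.trans hlt)⟩
  exact absurd (this.le hsm) (not_le.2 hb)

end OrderTypes

/-! ### The order type of the language of a nonterminal -/

theorem IsOrdinalGrammar.typeLE {T : Type} [LinearOrder T] {G : ContextFreeGrammar T}
    (hG : IsOrdinalGrammar G) (X : G.NT) : TypeLE (lang G X) (hG.orderType X) := by
  classical
  have := hG.wellOrdered X
  let r : lang G X → lang G X → Prop := fun u v => u.1 < v.1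
  refine ⟨fun w => if hw : w ∈ lang G X then Ordinal.typein r ⟨w, hw⟩ else 0, fun x hx => ?_,
    fun x hx y hy h => ?_⟩
  · simp only [dif_pos hx]
    exact Ordinal.typein_lt_type r _
  · simp only [dif_pos hx, dif_pos hy]
    exact (Ordinal.typein_lt_typein r).2 h

theorem IsOrdinalGrammar.typeGE {T : Type} [LinearOrder T] {G : ContextFreeGrammar T}
    (hG : IsOrdinalGrammar G) (X : G.NT) : TypeGE (lang G X) (hG.orderType X) := by
  classical
  have := hG.wellOrdered X
  let r : lang G X → lang G X → Prop := fun u v => u.1 < v.1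
  refine ⟨fun c => if hc : c < Ordinal.type r then (Ordinal.enum r ⟨c, hc⟩).1 else [], fun c hc => ?_,
    fun c d h hd => ?_⟩
  · have hc : c < Ordinal.type r := hc
    simp only [dif_pos hc]
    exact (Ordinal.enum r ⟨c, hc⟩).2
  · have hd : d < Ordinal.type r := hd
    simp only [dif_pos hd, dif_pos (h.trans hd)]
    exact (Ordinal.enum_lt_enum (r := r)).2 h

/-! ### Sentential forms -/

section Sentential

variable {T N : Type}

/-- The longest prefix consisting of terminals. -/
def terminalPrefix : List (Symbol T N) → List T
  | Symbol.terminal a :: α => a :: terminalPrefix α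
  | _ => []

/-- The nonterminals of a sentential form, from left to right. -/
def nonterminals : List (Symbol T N) → List N
  | [] => []
  | Symbol.terminal _ :: α => nonterminals α
  | Symbol.nonterminal X :: α => X :: nonterminals α

theorem mem_nonterminals {X : N} {α : List (Symbol T N)} :
    X ∈ nonterminals α ↔ Symbol.nonterminal X ∈ α := by
  induction α with
  | nil => simp [nonterminals]
  | cons s α ih => cases s <;> simp [nonterminals, ih]

theorem eq_terminals_of_nonterminals_eq_nil {α : List (Symbol T N)} (h : nonterminals α = []) :
    α = (terminalPrefix α).map Symbol.terminal := by
  induction α with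
  | nil => simp [terminalPrefix]
  | cons s α ih =>
    cases s with
    | terminal a =>
      simp only [terminalPrefix, List.map_cons, List.cons.injEq, true_and]
      exact ih (by simpa [nonterminals] using h)
    | nonterminal X => simp [nonterminals] at h

theorem exists_of_nonterminals_eq_cons {α : List (Symbol T N)} {Y : N} {δ : List N}
    (h : nonterminals α = Y :: δ) : ∃ β, nonterminals β = δ ∧
      α = (terminalPrefix α).map Symbol.terminal ++ Symbol.nonterminal Y :: β := by
  induction α with
  | nil => simp [nonterminals] at h
  | cons s α ih =>
    cases s with
    | terminal a =>
      obtain ⟨β, h1, h2⟩ := ih (by simpa [nonterminals] using h)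
      refine ⟨β, h1, ?_⟩
      simp only [terminalPrefix, List.map_cons, List.cons_append, List.cons.injEq, true_and]
      exact h2
    | nonterminal X =>
      simp only [nonterminals, List.cons.injEq] at h
      exact ⟨α, h.2, by simp [terminalPrefix, h.1]⟩

variable {G : ContextFreeGrammar T}

/-- The terminal words derivable from a sentential form. -/
def formLang (G : ContextFreeGrammar T) (α : List (Symbol T G.NT)) : Set (List T) :=
  {w | G.Derives α (w.map Symbol.terminal)}

/-- Context-freeness: every rewriting step takes place inside one of the two halves. -/
theorem derives_append_iff {α β γ : List (Symbol T G.NT)} :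
    G.Derives (α ++ β) γ ↔ ∃ γ₁ γ₂, γ = γ₁ ++ γ₂ ∧ G.Derives α γ₁ ∧ G.Derives β γ₂ := by
  constructor
  · intro h
    induction h with
    | refl => exact ⟨α, β, rfl, .refl _, .refl _⟩
    | tail _ hs ih =>
      obtain ⟨γ₁, γ₂, rfl, h1, h2⟩ := ih
      obtain ⟨r, hr, hs⟩ := hs
      obtain ⟨p, q, e, rfl⟩ := ContextFreeRule.rewrites_iff.1 hs
      rw [List.append_assoc, List.append_eq_append_iff] at e
      rcases e with ⟨c, rfl, e⟩ | ⟨c, rfl, e⟩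
      · refine ⟨γ₁, c ++ r.output ++ q, by simp, h1, h2.trans_produces ?_⟩
        refine ⟨r, hr, ContextFreeRule.rewrites_iff.2 ⟨c, q, ?_, rfl⟩⟩
        rw [e, List.append_assoc]
      -- If `c` is empty, the rewritten nonterminal is the first symbol of the second half;
      -- otherwise it lies in the first half.
      · cases c with
        | nil =>
          refine ⟨p, r.output ++ q, by simp, by simpa using h1, h2.trans_produces ?_⟩
          refine ⟨r, hr, ContextFreeRule.rewrites_iff.2 ⟨[], q, ?_, rfl⟩⟩
          simpa using e.symm
        | cons s c =>
          simp only [List.cons_append, List.nil_append, List.cons.injEq] at e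
          obtain ⟨rfl, rfl⟩ := e
          refine ⟨p ++ r.output ++ c, γ₂, by simp, h1.trans_produces ?_, h2⟩
          exact ⟨r, hr, ContextFreeRule.rewrites_iff.2 ⟨p, c, by simp, rfl⟩⟩
  · rintro ⟨γ₁, γ₂, rfl, h1, h2⟩
    exact (h1.append_right β).trans (h2.append_left γ₁)

theorem formLang_append (α β : List (Symbol T G.NT)) :
    formLang G (α ++ β) = Set.image2 (· ++ ·) (formLang G α) (formLang G β) := by
  ext w
  simp only [formLang, Set.mem_ofPred_eq, derives_append_iff, Set.mem_image2]
  constructor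
  · rintro ⟨γ₁, γ₂, e, h1, h2⟩
    obtain ⟨w₁, w₂, rfl, rfl, rfl⟩ := List.map_eq_append_iff.1 e
    exact ⟨w₁, h1, w₂, h2, rfl⟩
  · rintro ⟨w₁, h1, w₂, h2, rfl⟩
    exact ⟨_, _, by simp, h1, h2⟩

theorem derives_terminals_iff {u : List T} {γ : List (Symbol T G.NT)} :
    G.Derives (u.map Symbol.terminal) γ ↔ γ = u.map Symbol.terminal := by
  constructor
  · intro h
    rcases h.eq_or_head with h | ⟨v, ⟨r, hr, hs⟩, h⟩
    · exact h.symm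
    · have := hs.nonterminal_input_mem
      simp at this
  · rintro rfl
    exact .refl _

theorem formLang_terminals (u : List T) :
    formLang G (u.map (Symbol.terminal (N := G.NT))) = {u} := by
  ext w
  simp only [formLang, Set.mem_ofPred_eq, derives_terminals_iff, Set.mem_singleton_iff]
  refine ⟨fun h => ?_, fun h => by rw [h]⟩
  exact List.map_injective_iff.2 (fun _ _ h => by simpa using h) h

theorem formLang_cons_nonterminal (X : G.NT) (α : List (Symbol T G.NT)) :
    formLang G (Symbol.nonterminal X :: α) = Set.image2 (· ++ ·) (lang G X) (formLang G α) :=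
  formLang_append [Symbol.nonterminal X] α

theorem formLang_terminals_append (u : List T) (α : List (Symbol T G.NT)) :
    formLang G (u.map Symbol.terminal ++ α) = (u ++ ·) '' formLang G α := by
  rw [formLang_append, formLang_terminals, Set.image2_singleton_left]

theorem formLang_cons_terminal (a : T) (α : List (Symbol T G.NT)) :
    formLang G (Symbol.terminal a :: α) = ([a] ++ ·) '' formLang G α :=
  formLang_terminals_append [a] α

theorem mem_lang_iff {X : G.NT} {w : List T} :
    w ∈ lang G X ↔ ∃ r ∈ G.rules, r.input = X ∧ w ∈ formLang G r.output := by
  constructor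
  · intro h
    rcases ContextFreeGrammar.Derives.eq_or_head h with h | ⟨v, ⟨r, hr, hs⟩, h⟩
    · cases w <;> simp at h
    · obtain ⟨p, q, e, rfl⟩ := ContextFreeRule.rewrites_iff.1 hs
      have hp : p = [] := by
        cases p with
        | nil => rfl
        | cons _ _ => simp at e
      subst hp
      simp only [List.nil_append, List.singleton_append, List.cons.injEq,
        Symbol.nonterminal.injEq] at e
      obtain ⟨rfl, rfl⟩ := e
      exact ⟨r, hr, rfl, by simpa [formLang] using h⟩
  · rintro ⟨r, hr, rfl, h⟩
    exact ContextFreeGrammar.Produces.trans_derives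
      ⟨r, hr, ContextFreeRule.Rewrites.input_output⟩ h

/-- `Y` occurs in a production of `X`. -/
def Calls (G : ContextFreeGrammar T) (X Y : G.NT) : Prop :=
  ∃ r ∈ G.rules, r.input = X ∧ Y ∈ nonterminals r.output

/-- `Y` occurs in a sentential form derivable from `X`. -/
abbrev Reach (G : ContextFreeGrammar T) : G.NT → G.NT → Prop := Relation.ReflTransGen (Calls G)

theorem reach_of_derives {X Y : G.NT} {α : List (Symbol T G.NT)}
    (h : G.Derives [Symbol.nonterminal X] α) (hY : Symbol.nonterminal Y ∈ α) : Reach G X Y := by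
  induction h generalizing Y with
  | refl =>
    simp only [List.mem_singleton, Symbol.nonterminal.injEq] at hY
    exact hY ▸ .refl
  | tail _ hs ih =>
    obtain ⟨r, hr, hs⟩ := hs
    obtain ⟨p, q, rfl, rfl⟩ := ContextFreeRule.rewrites_iff.1 hs
    simp only [List.mem_append] at hY ih
    rcases hY with (hY | hY) | hY
    · exact ih (by simp [hY])
    · exact (ih (by simp)).tail ⟨r, hr, rfl, mem_nonterminals.2 hY⟩
    · exact ih (by simp [hY])

theorem transGen_calls_of_isRecursive {X : G.NT} (h : IsRecursive G X) :
    Relation.TransGen (Calls G) X X := by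
  obtain ⟨α, β, h⟩ := h
  obtain ⟨γ, ⟨r, hr, hs⟩, h⟩ := (Relation.TransGen.head'_iff).1 h
  obtain ⟨p, q, e, rfl⟩ := ContextFreeRule.rewrites_iff.1 hs
  have hp : p = [] := by
    cases p with
    | nil => rfl
    | cons _ _ => simp at e
  subst hp
  simp only [List.nil_append, List.singleton_append, List.cons.injEq,
    Symbol.nonterminal.injEq] at e
  obtain ⟨rfl, rfl⟩ := e
  simp only [List.nil_append, List.append_nil] at h
  have key : ∀ γ, G.Derives r.output γ → ∀ Y, Symbol.nonterminal Y ∈ γ →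
      Relation.TransGen (Calls G) r.input Y := by
    intro γ h
    induction h with
    | refl => exact fun Y hY => .single ⟨r, hr, rfl, mem_nonterminals.2 hY⟩
    | tail _ hs ih =>
      intro Y hY
      obtain ⟨r', hr', hs⟩ := hs
      obtain ⟨p, q, rfl, rfl⟩ := ContextFreeRule.rewrites_iff.1 hs
      simp only [List.mem_append] at hY ih
      rcases hY with (hY | hY) | hY
      · exact ih Y (by simp [hY])
      · exact (ih r'.input (by simp)).tail ⟨r', hr', rfl, mem_nonterminals.2 hY⟩
      · exact ih Y (by simp [hY])
  exact key _ h r.input (by simp)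

theorem formLang_nonempty (h : ∀ X : G.NT, (lang G X).Nonempty) (α : List (Symbol T G.NT)) :
    (formLang G α).Nonempty := by
  induction α with
  | nil => exact ⟨[], .refl _⟩
  | cons s α ih =>
    cases s with
    | terminal a =>
      rw [formLang_cons_terminal]
      exact ih.image _
    | nonterminal X =>
      rw [formLang_cons_nonterminal]
      exact (h X).image2 ih

theorem PrefixFree.image2_append {A B : Set (List T)} (hA : PrefixFree A) (hB : PrefixFree B) :
    PrefixFree (Set.image2 (· ++ ·) A B) := by
  rintro _ ⟨x, hx, y, hy, rfl⟩ _ ⟨x', hx', y', hy', rfl⟩ h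
  obtain ⟨z, hz⟩ := h
  simp only [List.append_assoc] at hz
  obtain ⟨rfl, h⟩ := hA.eq_of_append_eq hx hx' hz
  rw [hB _ hy _ hy' ⟨z, h⟩]

theorem PrefixFree.image_append {A : Set (List T)} (hA : PrefixFree A) (u : List T) :
    PrefixFree ((u ++ ·) '' A) := by
  rintro _ ⟨x, hx, rfl⟩ _ ⟨y, hy, rfl⟩ h
  rw [hA x hx y hy ((List.prefix_append_right_inj u).1 h)]

/-- `uwz` lies in the language of `X` for some fixed `z` and all `w` in the language of `Y`. -/
def Context (G : ContextFreeGrammar T) (X : G.NT) (u : List T) (Y : G.NT) : Prop :=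
  ∃ z : List T, ∀ w ∈ lang G Y, u ++ w ++ z ∈ lang G X

theorem Context.refl (X : G.NT) : Context G X [] X := ⟨[], fun w hw => by simpa using hw⟩

theorem Context.trans {X Y Z : G.NT} {u v : List T} (h : Context G X u Y) (h' : Context G Y v Z) :
    Context G X (u ++ v) Z := by
  obtain ⟨z, hz⟩ := h
  obtain ⟨z', hz'⟩ := h'
  exact ⟨z' ++ z, fun w hw => by simpa using hz _ (hz' w hw)⟩

theorem Context.pow {X : G.NT} {u : List T} (h : Context G X u X) (n : ℕ) :
    Context G X (wordPow u n) X := by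
  induction n with
  | zero => exact .refl X
  | succ n ih => exact h.trans ih

/-- The right part `z` is one fixed word derived from what follows `Y`, available because every
language is nonempty. -/
theorem context_of_mem_rules (h : ∀ X : G.NT, (lang G X).Nonempty) {r : ContextFreeRule T G.NT}
    (hr : r ∈ G.rules) {α β : List (Symbol T G.NT)} {Y : G.NT}
    (he : r.output = α ++ Symbol.nonterminal Y :: β) {u : List T} (hu : u ∈ formLang G α) :
    Context G r.input u Y := by
  obtain ⟨z, hz⟩ := formLang_nonempty h β
  refine ⟨z, fun w hw => mem_lang_iff.2 ⟨r, hr, rfl, ?_⟩⟩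
  rw [he, formLang_append, formLang_cons_nonterminal, List.append_assoc]
  exact ⟨u, hu, _, ⟨w, hw, z, hz, rfl⟩, rfl⟩

theorem context_terminalPrefix (h : ∀ X : G.NT, (lang G X).Nonempty) {r : ContextFreeRule T G.NT}
    (hr : r ∈ G.rules) {Y : G.NT} {δ : List G.NT} (he : nonterminals r.output = Y :: δ) :
    Context G r.input (terminalPrefix r.output) Y := by
  obtain ⟨β, -, hβ⟩ := exists_of_nonterminals_eq_cons he
  refine context_of_mem_rules h hr hβ ?_
  rw [formLang_terminals]
  rfl

theorem exists_context_of_reach (h : ∀ X : G.NT, (lang G X).Nonempty) {X Y : G.NT}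
    (hXY : Reach G X Y) : ∃ u, Context G X u Y := by
  induction hXY with
  | refl => exact ⟨[], .refl X⟩
  | tail _ hs ih =>
    obtain ⟨u, hu⟩ := ih
    obtain ⟨r, hr, rfl, hY⟩ := hs
    obtain ⟨α, β, e⟩ := List.append_of_mem (mem_nonterminals.1 hY)
    obtain ⟨v, hv⟩ := formLang_nonempty h α
    exact ⟨u ++ v, hu.trans (context_of_mem_rules h hr e hv)⟩

/-- The number of nonterminals reachable from `X`. -/
noncomputable def rank (G : ContextFreeGrammar T) (X : G.NT) : ℕ := {Y | Reach G X Y}.ncard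

theorem rank_le_of_reach [Finite G.NT] {X Y : G.NT} (h : Reach G X Y) : rank G Y ≤ rank G X :=
  Set.ncard_le_ncard (fun _ hZ => h.trans hZ) (Set.toFinite _)

theorem rank_lt_of_not_reach [Finite G.NT] {X Y : G.NT} (h : Reach G X Y) (h' : ¬ Reach G Y X) :
    rank G Y < rank G X := by
  refine Set.ncard_lt_ncard ?_ (Set.toFinite _)
  refine Set.ssubset_iff_of_subset (fun _ hZ => h.trans hZ) |>.2 ⟨X, .refl, h'⟩

theorem reach_of_rank_eq [Finite G.NT] {X Y : G.NT} (h : Reach G X Y) (h' : rank G X ≤ rank G Y) :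
    Reach G Y X := by
  by_contra h''
  exact absurd (rank_lt_of_not_reach h h'') (not_lt.2 h')

theorem IsNormalForm.lang_nonempty (hN : IsNormalForm G) (X : G.NT) : (lang G X).Nonempty :=
  (hN.infinite X).nonempty

theorem IsNormalForm.terminalPrefix_ne_nil (hN : IsNormalForm G) {r : ContextFreeRule T G.NT}
    (hr : r ∈ G.rules) : terminalPrefix r.output ≠ [] := by
  obtain ⟨a, α, h⟩ := hN.terminal_head r hr
  simp [h, terminalPrefix]

end Sentential

/-! ### Loops and the infinite word bounding a language -/

section OrdinalGrammars

open Ordinal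

variable {T : Type} [LinearOrder T] {G : ContextFreeGrammar T}

theorem IsOrdinalGrammar.prefixFree_formLang (hG : IsOrdinalGrammar G)
    (α : List (Symbol T G.NT)) : PrefixFree (formLang G α) := by
  induction α with
  | nil =>
    have := formLang_terminals (G := G) []
    simp only [List.map_nil] at this
    rw [this]
    rintro _ rfl _ rfl _
    rfl
  | cons s α ih =>
    cases s with
    | terminal a =>
      rw [formLang_cons_terminal]
      exact ih.image_append _
    | nonterminal X =>
      rw [formLang_cons_nonterminal]
      exact (hG.prefixFree X).image2_append ih

theorem Context.typeGE {X Y : G.NT} {u : List T} (h : Context G X u Y) (hG : IsOrdinalGrammar G)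
    {o : Ordinal} (ho : TypeGE (lang G Y) o) : TypeGE (lang G X) o := by
  obtain ⟨z, hz⟩ := h
  exact ho.of_context (hG.prefixFree Y) u z hz

/-- The exponent of the order type of `X₁ ⋯ Xₖ` when `X` has type `ω ^ a X`. -/
noncomputable def exponent {N : Type} (a : N → Ordinal.{0}) : List N → Ordinal.{0}
  | [] => 0
  | X :: δ => exponent a δ + a X

theorem typeLE_formLang (hG : IsOrdinalGrammar G) (a : G.NT → Ordinal.{0})
    (α : List (Symbol T G.NT)) (h : ∀ Z ∈ nonterminals α, TypeLE (lang G Z) (ω ^ a Z)) :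
    TypeLE (formLang G α) (ω ^ exponent a (nonterminals α)) := by
  induction α with
  | nil =>
    have := formLang_terminals (G := G) []
    simp only [List.map_nil] at this
    rw [this]
    simpa [nonterminals, exponent] using typeLE_singleton []
  | cons s α ih =>
    cases s with
    | terminal b =>
      rw [formLang_cons_terminal]
      exact (ih h).image_append _
    | nonterminal X =>
      rw [formLang_cons_nonterminal, nonterminals, exponent, opow_add]
      exact TypeLE.image2_append (hG.prefixFree X) (h X (by simp [nonterminals]))
        (ih fun Z hZ => h Z (by simp [nonterminals, hZ]))

theorem typeGE_formLang (hG : IsOrdinalGrammar G) (a : G.NT → Ordinal.{0})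
    (α : List (Symbol T G.NT)) (h : ∀ Z ∈ nonterminals α, TypeGE (lang G Z) (ω ^ a Z)) :
    TypeGE (formLang G α) (ω ^ exponent a (nonterminals α)) := by
  induction α with
  | nil =>
    have := formLang_terminals (G := G) []
    simp only [List.map_nil] at this
    rw [this]
    refine ⟨fun _ => [], fun _ _ => rfl, fun c d hcd hd => ?_⟩
    simp only [nonterminals, exponent, opow_zero, Order.lt_one_iff] at hd
    simp [hd] at hcd
  | cons s α ih =>
    cases s with
    | terminal b =>
      rw [formLang_cons_terminal]
      refine (ih h).of_context (hG.prefixFree_formLang α) [b] [] fun w hw => ⟨w, hw, by simp⟩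
    | nonterminal X =>
      rw [formLang_cons_nonterminal, nonterminals, exponent, opow_add]
      exact TypeGE.image2_append (hG.prefixFree X) (h X (by simp [nonterminals]))
        (ih fun Z hZ => h Z (by simp [nonterminals, hZ]))

theorem typeGE_formLang_of_mem (hG : IsOrdinalGrammar G) (hne : ∀ X : G.NT, (lang G X).Nonempty)
    {α : List (Symbol T G.NT)} {Z : G.NT} (hZ : Z ∈ nonterminals α) {o : Ordinal}
    (ho : TypeGE (lang G Z) o) : TypeGE (formLang G α) o := by
  obtain ⟨β, γ, rfl⟩ := List.append_of_mem (mem_nonterminals.1 hZ)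
  obtain ⟨u, hu⟩ := formLang_nonempty hne β
  obtain ⟨v, hv⟩ := formLang_nonempty hne γ
  refine ho.of_context (hG.prefixFree Z) u v fun w hw => ?_
  rw [formLang_append, formLang_cons_nonterminal, List.append_assoc]
  exact ⟨u, hu, _, ⟨w, hw, v, hv, rfl⟩, rfl⟩

theorem typeGE_of_rule {r : ContextFreeRule T G.NT} (hr : r ∈ G.rules)
    {o : Ordinal} (ho : TypeGE (formLang G r.output) o) : TypeGE (lang G r.input) o :=
  ho.mono (fun _ hw => mem_lang_iff.2 ⟨r, hr, rfl, hw⟩) le_rfl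

/-- A production `X → vYδ` with `Z` in `δ` multiplies the types of `Y` and `Z`. -/
theorem typeGE_mul_of_rule (hG : IsOrdinalGrammar G) (hN : IsNormalForm G)
    {r : ContextFreeRule T G.NT} (hr : r ∈ G.rules) {Y Z : G.NT} {δ : List G.NT}
    (he : nonterminals r.output = Y :: δ) (hZ : Z ∈ δ) {a b : Ordinal}
    (ha : TypeGE (lang G Z) a) (hb : TypeGE (lang G Y) b) : TypeGE (lang G r.input) (a * b) := by
  obtain ⟨β, rfl, hβ⟩ := exists_of_nonterminals_eq_cons he
  refine typeGE_of_rule hr ?_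
  have := TypeGE.image2_append (hG.prefixFree Y) hb (typeGE_formLang_of_mem hG hN.lang_nonempty hZ ha)
  rw [← formLang_cons_nonterminal] at this
  rw [hβ, formLang_terminals_append]
  exact this.of_context (hG.prefixFree_formLang _) (terminalPrefix r.output) []
    fun w hw => ⟨w, hw, by simp⟩

theorem orderType_pos (hG : IsOrdinalGrammar G) (hN : IsNormalForm G) (X : G.NT) :
    0 < hG.orderType X := by
  obtain ⟨w, hw⟩ := hN.lang_nonempty X
  obtain ⟨f, f1, -⟩ := hG.typeLE X
  exact zero_le.trans_lt (f1 w hw)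

theorem typeGE_omega0 (hG : IsOrdinalGrammar G) (hN : IsNormalForm G) (X : G.NT) :
    TypeGE (lang G X) ω :=
  typeGE_omega0_of_infinite (hG.typeLE X) (hG.typeGE X) (hN.infinite X)

/-- If `Z` led back to `X`, then L(Z) would contain a copy of o(X), and placing it after the
infinite L(Y) would give o(X)·ω ≤ o(X). Recursion can therefore only pass through the leading
nonterminal. -/
theorem not_reach_of_mem_tail (hG : IsOrdinalGrammar G) (hN : IsNormalForm G)
    {r : ContextFreeRule T G.NT} (hr : r ∈ G.rules) {Y Z : G.NT} {δ : List G.NT}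
    (he : nonterminals r.output = Y :: δ) (hZ : Z ∈ δ) : ¬ Reach G Z r.input := by
  intro h
  obtain ⟨u, hu⟩ := exists_context_of_reach hN.lang_nonempty h
  have h1 := typeGE_mul_of_rule hG hN hr he hZ (hu.typeGE hG (hG.typeGE r.input))
    (typeGE_omega0 hG hN Y)
  have h2 := h1.le (hG.typeLE r.input)
  have h3 : hG.orderType r.input * 1 < hG.orderType r.input * ω :=
    mul_lt_mul_of_pos_left one_lt_omega0 (orderType_pos hG hN r.input)
  rw [mul_one] at h3
  exact absurd h3 (not_lt.2 h2)

/-- Words of a nonterminal with a loop `u` lie strictly below `uuu⋯`. -/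
theorem Context.exists_strictLex_wordPow {X : G.NT} {u : List T} (h : Context G X u X)
    (hu : u ≠ []) (hG : IsOrdinalGrammar G) {w : List T} (hw : w ∈ lang G X) :
    ∃ n, StrictLex w (wordPow u n) := by
  have hlen : 0 < u.length := List.length_pos_iff.2 hu
  -- The power of `u` is taken longer than `w`, which rules out its being a prefix of `w`.
  have hl : w.length < (wordPow u (w.length + 1)).length := by
    rw [length_wordPow]
    nlinarith
  refine ⟨w.length + 1, ?_⟩
  set p := wordPow u (w.length + 1)
  have hp : Context G X p X := h.pow _
  rcases strictLex_trichotomy w p with h' | h' | h' | h'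
  · exact h'
  -- If `w` exceeds `p`, the words pⁿwzₙ form an infinite descending sequence in L(X).
  · exfalso
    choose z hz using fun n => hp.pow n
    have hmem : ∀ n, wordPow p n ++ w ++ z n ∈ lang G X := fun n => hz n w hw
    obtain ⟨f, -, f2⟩ := hG.typeLE X
    have hlt : ∀ n, f (wordPow p (n + 1) ++ w ++ z (n + 1)) < f (wordPow p n ++ w ++ z n) := by
      intro n
      refine f2 _ (hmem _) _ (hmem _) (StrictLex.lt ?_)
      rw [wordPow_add, wordPow_one]
      simp only [List.append_assoc, strictLex_append_left]
      exact h'.append _ _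
    exact (RelEmbedding.natGT _ hlt).not_wellFounded wellFounded_lt
  -- If `w` is a prefix of `p`, it is a proper prefix of another word of L(X).
  · exfalso
    obtain ⟨z, hz⟩ := hp
    have h1 := hz w hw
    have h2 : w <+: p ++ w ++ z := by
      rw [List.append_assoc]
      exact h'.trans (List.prefix_append _ _)
    have h3 := congrArg List.length (hG.prefixFree X w hw _ h1 h2)
    simp only [List.length_append] at h3
    omega
  · exact absurd h'.length_le (not_le.2 hl)

/-- Some word of L(X) begins with `p` and lies below a power of `s`. If `p` exceeded a power of `s`,
that would compare two powers of `s` strictly, although one is a prefix of the other. -/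
theorem Context.not_strictLex {X Z : G.NT} {p s : List T} (h : Context G X p Z)
    (hs : Context G X s X) (hs0 : s ≠ []) (hG : IsOrdinalGrammar G) (hN : IsNormalForm G) (m : ℕ) :
    ¬ StrictLex (wordPow s m) p := by
  intro hlt
  obtain ⟨w, hw⟩ := hN.lang_nonempty Z
  obtain ⟨z, hz⟩ := h
  obtain ⟨n, hn⟩ := hs.exists_strictLex_wordPow hs0 hG (hz w hw)
  rw [List.append_assoc] at hn
  exact not_strictLex_wordPow s m n ((hlt.append_right _).trans hn)

/-- The word `ut` cannot exceed `sss⋯`. If it were a prefix of it, then `su` would be one as well;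
the two have equal length, so they would coincide. -/
theorem Context.strictLex_of_ne {X Y : G.NT} {u s t : List T} (h : Context G X u Y)
    (hs : Context G X s X) (ht : Context G Y t Y) (hs0 : s ≠ []) (hst : s.length = t.length)
    (hG : IsOrdinalGrammar G) (hN : IsNormalForm G) (hne : s ++ u ≠ u ++ t) :
    ∃ m, StrictLex (u ++ t) (wordPow s m) := by
  have hlen : 0 < s.length := List.length_pos_iff.2 hs0
  refine ⟨u.length + t.length + 1, ?_⟩
  have hl : (u ++ t).length < (wordPow s (u.length + t.length + 1)).length := by
    rw [length_wordPow, List.length_append]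
    nlinarith
  rcases strictLex_trichotomy (u ++ t) (wordPow s (u.length + t.length + 1)) with h' | h' | h' | h'
  · exact h'
  · exact absurd h' ((h.trans ht).not_strictLex hs hs0 hG hN _)
  · exfalso
    have h1 : u ++ t <+: wordPow s (u.length + t.length + 1 + 1) :=
      h'.trans (wordPow_prefix s (by omega))
    have h2 : s ++ u <+: wordPow s (u.length + t.length + 1 + 1) :=
      (List.prefix_append_right_inj s).2 ((List.prefix_append u t).trans h')
    refine hne (List.IsPrefix.eq_of_length (List.prefix_of_prefix_length_le h2 h1 ?_) ?_)
    · simp [hst, Nat.add_comm]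
    · simp [hst, Nat.add_comm]
  · exact absurd h'.length_le (not_le.2 hl)

/-- A word of L(Y) is strictly below `ttt⋯`, so it either drops below `t` already or extends `t`. In
both cases the strict comparison of `ut` carries over. -/
theorem Context.strictLex_of_strictLex {Y : G.NT} {u s t : List T} (ht : Context G Y t Y)
    (ht0 : t ≠ []) (hG : IsOrdinalGrammar G) {m : ℕ} (h : StrictLex (u ++ t) (wordPow s m))
    {w : List T} (hw : w ∈ lang G Y) : StrictLex (u ++ w) (wordPow s m) := by
  obtain ⟨k, hk⟩ := ht.exists_strictLex_wordPow ht0 hG hw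
  rcases strictLex_trichotomy w t with h' | h' | h' | h'
  · exact ((strictLex_append_left u _ _).2 h').trans h
  · exfalso
    have := (h'.trans hk).of_prefix_right (wordPow_prefix t (Nat.le_succ k))
    simp only [wordPow] at this
    exact this.not_prefix (List.prefix_append _ _)
  · have := hk.of_prefix_right (wordPow_prefix t (Nat.le_succ k))
    simp only [wordPow] at this
    exact absurd (h'.trans (List.prefix_append _ _)) this.not_prefix
  · obtain ⟨z, rfl⟩ := h'
    rw [← List.append_assoc]
    exact h.append_left z

/-- Returning from `Y` to `X` turns `ut` into the start of a loop of `X`. If the words differed,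
this loop would be strictly below a power of `s`; but that power is itself a context of `X` and
cannot exceed any loop of `X`. -/
theorem Context.comm_of_reach {X Y : G.NT} {u s t : List T} (h : Context G X u Y)
    (hs : Context G X s X) (ht : Context G Y t Y) (hs0 : s ≠ []) (hst : s.length = t.length)
    (hG : IsOrdinalGrammar G) (hN : IsNormalForm G) (hYX : Reach G Y X) : s ++ u = u ++ t := by
  by_contra hne
  obtain ⟨m, hm⟩ := h.strictLex_of_ne hs ht hs0 hst hG hN hne
  obtain ⟨p, hp⟩ := exists_context_of_reach hN.lang_nonempty hYX
  have hk := (h.trans ht).trans hp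
  have ht0 : t ≠ [] := by
    rintro rfl
    exact hs0 (List.length_eq_zero_iff.1 (by simpa using hst))
  refine (hs.pow m).not_strictLex hk (by simp [ht0]) hG hN 1 ?_
  rw [wordPow_one]
  exact hm.append_left p

theorem rank_lt_of_mem_tail [Finite G.NT] (hG : IsOrdinalGrammar G) (hN : IsNormalForm G)
    {r : ContextFreeRule T G.NT} (hr : r ∈ G.rules) {Y Z : G.NT} {δ : List G.NT}
    (he : nonterminals r.output = Y :: δ) (hZ : Z ∈ δ) : rank G Z < rank G r.input :=
  rank_lt_of_not_reach (.single ⟨r, hr, rfl, by simp [he, hZ]⟩)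
    (not_reach_of_mem_tail hG hN hr he hZ)

end OrdinalGrammars

/-! ### Upper and lower bounds for the exponents -/

section Bounds

open Ordinal

variable {T : Type} {G : ContextFreeGrammar T}

/-- Loops of a common length for the nonterminals of a set closed under the productions. -/
structure IsLoopSystem (G : ContextFreeGrammar T) (M : Set G.NT) (U : G.NT → List T) (l : ℕ) :
    Prop where
  closed : ∀ r ∈ G.rules, r.input ∈ M → ∀ Z ∈ nonterminals r.output, Z ∈ M
  pos : 0 < l
  length : ∀ X ∈ M, (U X).length = l
  loop : ∀ X ∈ M, Context G X (U X) X

theorem IsLoopSystem.ne_nil {M : Set G.NT} {U : G.NT → List T} {l : ℕ}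
    (hU : IsLoopSystem G M U l) {X : G.NT} (hX : X ∈ M) : U X ≠ [] := by
  intro h
  have := hU.length X hX
  rw [h] at this
  exact hU.pos.ne this

/-- The words of the right-hand side stay a bounded distance below the supremum of the language. -/
def IsBounded {N : Type} (U : N → List T) (r : ContextFreeRule T N) : Prop :=
  ∀ Y ∈ (nonterminals r.output).head?,
    U r.input ++ terminalPrefix r.output ≠ terminalPrefix r.output ++ U Y

open Classical in
/-- The contribution of a production to the exponent of the order type of its left-hand side. -/
noncomputable def ruleExponent {N : Type} (a : N → Ordinal.{0}) (U : N → List T)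
    (r : ContextFreeRule T N) : Ordinal.{0} :=
  exponent a (nonterminals r.output) + if IsBounded U r then 1 else 0

variable [LinearOrder T]

/-- By `Context.comm_of_reach`, a production whose leading nonterminal leads back to its left-hand
side cannot be bounded. Bounded productions thus refer only to lower ranks. -/
theorem rank_lt_of_isBounded [Finite G.NT] (hG : IsOrdinalGrammar G) (hN : IsNormalForm G)
    {M : Set G.NT} {U : G.NT → List T} {l : ℕ} (hU : IsLoopSystem G M U l)
    {r : ContextFreeRule T G.NT} (hr : r ∈ G.rules) (hM : r.input ∈ M) {Y : G.NT} {δ : List G.NT}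
    (he : nonterminals r.output = Y :: δ) (hb : IsBounded U r) : rank G Y < rank G r.input := by
  have hY : Y ∈ M := hU.closed r hr hM Y (by simp [he])
  refine rank_lt_of_not_reach (.single ⟨r, hr, rfl, by simp [he]⟩) fun h => ?_
  exact hb Y (by simp [he]) ((context_terminalPrefix hN.lang_nonempty hr he).comm_of_reach
    (hU.loop _ hM) (hU.loop _ hY) (hU.ne_nil hM) ((hU.length _ hM).trans (hU.length _ hY).symm)
    hG hN h)

/-- The words `U r.input` and `U Y` commute past `v`, so `q` is compared with `v` followed by powers
of `U Y`. If `q` is a prefix of `v`, nothing of the production lies strictly below it. Otherwise `q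
= vq'` with `q'` shorter, because `v` is nonempty, and the words below `q` consist of `v`, a word of
L(Y) below `q'`, and an arbitrary tail. -/
theorem typeSmall_formLang_of_not_isBounded (hG : IsOrdinalGrammar G)
    {M : Set G.NT} {U : G.NT → List T} {l : ℕ} (hU : IsLoopSystem G M U l)
    {a : G.NT → Ordinal.{0}} {r : ContextFreeRule T G.NT} (hr : r ∈ G.rules) (hM : r.input ∈ M)
    {Y : G.NT} {δ : List G.NT} (he : nonterminals r.output = Y :: δ) (hb : ¬ IsBounded U r)
    (hv : terminalPrefix r.output ≠ [])
    (hδ : ∀ Z ∈ δ, TypeLE (lang G Z) (ω ^ a Z)) {q : List T} {m : ℕ}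
    (hq : q <+: wordPow (U r.input) m)
    (ih : ∀ q' : List T, q'.length < q.length → q' <+: wordPow (U Y) m →
      TypeSmall {w ∈ lang G Y | StrictLex w q'} (a Y)) :
    TypeSmall {w ∈ formLang G r.output | StrictLex w q} (exponent a (nonterminals r.output)) := by
  have hY : Y ∈ M := hU.closed r hr hM Y (by simp [he])
  obtain ⟨β, hβ, hout⟩ := exists_of_nonterminals_eq_cons he
  set v := terminalPrefix r.output with hvdef
  have hcomm : U r.input ++ v = v ++ U Y := by
    simp only [IsBounded, not_forall, not_not] at hb
    obtain ⟨Y', hY', h⟩ := hb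
    simp only [he, List.head?_cons, Option.mem_def, Option.some.injEq] at hY'
    exact hY' ▸ h
  have hq' : q <+: v ++ wordPow (U Y) m := by
    rw [← append_wordPow_of_comm hcomm]
    exact hq.trans (List.prefix_append _ _)
  rw [he, exponent, hout, formLang_terminals_append, formLang_cons_nonterminal]
  rcases List.prefix_or_prefix_of_prefix hq' (List.prefix_append v _) with h | h
  · refine (typeSmall_empty _).mono ?_
    rintro _ ⟨⟨_, _, rfl⟩, hlt⟩
    exact hlt.not_prefix' (h.trans (List.prefix_append _ _))
  · obtain ⟨q', rfl⟩ := h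
    rw [List.prefix_append_right_inj] at hq'
    obtain ⟨o, ho, hle⟩ := ih q' (by simpa using List.length_pos_iff.2 hv) hq'
    refine ⟨ω ^ exponent a δ * o, ?_, ?_⟩
    · rw [opow_add]
      exact mul_lt_mul_of_pos_left ho (opow_pos _ omega0_pos)
    · subst hβ
      refine ((TypeLE.image2_append ?_ hle (typeLE_formLang hG a β hδ)).image_append v).mono ?_ le_rfl
      · exact fun x hx y hy => hG.prefixFree Y x hx.1 y hy.1
      · rintro _ ⟨⟨_, ⟨y, hy, z, hz, rfl⟩, rfl⟩, hlt⟩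
        simp only [strictLex_append_left] at hlt
        refine ⟨_, ⟨y, ⟨hy, ?_⟩, z, hz, rfl⟩, rfl⟩
        rcases strictLex_trichotomy y q' with h | h | h | h
        · exact h
        · exact absurd (h.append_right z) hlt.asymm
        -- A word of L(Y) is strictly below a power of `U Y`, hence is not a prefix of one.
        · exfalso
          obtain ⟨k, hk⟩ := (hU.loop Y hY).exists_strictLex_wordPow (hU.ne_nil hY) hG hy
          have h1 := hk.of_prefix_right (wordPow_prefix (U Y) (le_max_left k m))
          exact h1.not_prefix ((h.trans hq').trans (wordPow_prefix (U Y) (le_max_right k m)))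
        · exact absurd (h.trans (List.prefix_append y z)) hlt.not_prefix'

/-- Every solution of the inequalities given by the productions bounds the order types. -/
theorem typeLE_lang_of_ruleExponent_le [Finite G.NT] (hG : IsOrdinalGrammar G)
    (hN : IsNormalForm G) {M : Set G.NT} {U : G.NT → List T} {l : ℕ} (hU : IsLoopSystem G M U l)
    {a : G.NT → Ordinal.{0}} (ha : ∀ X ∈ M, a X ≠ 0)
    (h : ∀ r ∈ G.rules, r.input ∈ M → ruleExponent a U r ≤ a r.input) :
    ∀ X ∈ M, TypeLE (lang G X) (ω ^ a X) := by
  classical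
  have main : ∀ n, ∀ X ∈ M, rank G X ≤ n → TypeLE (lang G X) (ω ^ a X) := by
    intro n
    induction n using Nat.strong_induction_on with
    | _ n ihn =>
    have ih : ∀ Z ∈ M, rank G Z < n → TypeLE (lang G Z) (ω ^ a Z) :=
      fun Z hZ hlt => ihn _ hlt Z hZ le_rfl
    -- Inside one rank the induction is on the length of the bounding prefix: passing to an
    -- equivalent leading nonterminal strips the nonempty terminal prefix.
    have inner : ∀ k, ∀ q : List T, q.length = k → ∀ X ∈ M, rank G X ≤ n → ∀ m,
        q <+: wordPow (U X) m → TypeSmall {w ∈ lang G X | StrictLex w q} (a X) := by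
      intro k
      induction k using Nat.strong_induction_on with
      | _ k ihk =>
      rintro q rfl X hX hn m hq
      have hsub : {w ∈ lang G X | StrictLex w q} ⊆ ⋃ r ∈ G.rules.filter (fun r => r.input = X),
          {w ∈ formLang G r.output | StrictLex w q} := by
        rintro w ⟨hw, hlt⟩
        obtain ⟨r, hr, e, hw⟩ := mem_lang_iff.1 hw
        simp only [Set.mem_iUnion]
        exact ⟨r, by simp [hr, e], hw, hlt⟩
      refine (TypeSmall.biUnion _ _ (ha X hX) fun r hr => ?_).mono hsub
      obtain ⟨hr', rfl⟩ := Finset.mem_filter.1 hr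
      clear hr hsub
      rename' hr' => hr
      have hle := h r hr hX
      cases he : nonterminals r.output with
      | nil =>
        refine ⟨1, one_lt_opow.2 ⟨one_lt_omega0, ha _ hX⟩,
          (typeLE_singleton (terminalPrefix r.output)).mono ?_ le_rfl⟩
        rw [eq_terminals_of_nonterminals_eq_nil he, formLang_terminals,
          ← eq_terminals_of_nonterminals_eq_nil he]
        exact fun w hw => hw.1
      | cons Y δ =>
        have hc := hU.closed r hr hX
        have hδ : ∀ Z ∈ δ, TypeLE (lang G Z) (ω ^ a Z) := fun Z hZ =>
          ih Z (hc Z (by simp [he, hZ])) ((rank_lt_of_mem_tail hG hN hr he hZ).trans_le hn)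
        by_cases hb : IsBounded U r
        · rw [ruleExponent, if_pos hb] at hle
          refine ⟨ω ^ exponent a (nonterminals r.output), ?_, ?_⟩
          · exact (opow_lt_opow_iff_right one_lt_omega0).2 (Order.add_one_le_iff.1 hle)
          · refine (typeLE_formLang hG a r.output fun Z hZ => ?_).mono (fun w hw => hw.1) le_rfl
            rw [he] at hZ
            rcases List.mem_cons.1 hZ with rfl | hZ
            · exact ih Z (hc Z (by simp [he])) ((rank_lt_of_isBounded hG hN hU hr hX he hb).trans_le hn)
            · exact hδ Z hZ
        · rw [ruleExponent, if_neg hb, add_zero] at hle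
          have hYn : rank G Y ≤ n :=
            (rank_le_of_reach (.single ⟨r, hr, rfl, by simp [he]⟩)).trans hn
          obtain ⟨o, ho, hs⟩ := typeSmall_formLang_of_not_isBounded hG hU hr hX he hb
            (hN.terminalPrefix_ne_nil hr) hδ hq
            fun q' hq' hp => ihk _ hq' q' rfl Y (hc Y (by simp [he])) hYn m hp
          exact ⟨o, ho.trans_le (opow_le_opow_right omega0_pos hle), hs⟩
    intro X hX hn
    refine typeLE_of_typeSmall (hG.prefixFree X) (hG.typeLE X) (hG.typeGE X) fun w hw => ?_
    obtain ⟨m, hm⟩ := (hU.loop X hX).exists_strictLex_wordPow (hU.ne_nil hX) hG hw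
    exact (inner _ _ rfl X hX hn m List.prefix_rfl).mono fun x hx => ⟨hx.1, hx.2.trans hm⟩
  exact fun X hX => main _ X hX le_rfl

/-- The copies pⁿBzₙ lie one above another: all of `B` is below `p`, so the n-th copy is decided
against every later one right after pⁿ. -/
theorem typeGE_mul_omega0 (hG : IsOrdinalGrammar G) {X : G.NT} {p : List T}
    (hp : Context G X p X) {B : Set (List T)} (hB : B ⊆ lang G X)
    (hlt : ∀ w ∈ B, StrictLex w p) {b : Ordinal} (hb : TypeGE B b) :
    TypeGE (lang G X) (b * ω) := by
  choose z hz using fun n => hp.pow n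
  obtain ⟨g, g1, g2⟩ := hb
  -- `κ` reads a finite ordinal as a natural number; its value at infinite ordinals plays no role.
  have hκ : ∀ d : Ordinal.{0}, ∃ n : ℕ, d < ω → d = n := fun d => by
    by_cases hd : d < ω
    · obtain ⟨n, hn⟩ := lt_omega0.1 hd
      exact ⟨n, fun _ => hn⟩
    · exact ⟨0, fun h => absurd h hd⟩
  choose κ hκ using hκ
  have h0 : ∀ c < b * ω, b ≠ 0 := by rintro c hc rfl; simp at hc
  have hd : ∀ c < b * ω, c / b = κ (c / b) := fun c hc =>
    hκ _ ((lt_mul_iff_div_lt (h0 c hc)).1 hc)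
  have hm : ∀ c < b * ω, c % b < b := fun c hc => mod_lt c (h0 c hc)
  refine ⟨fun c => wordPow p (κ (c / b)) ++ g (c % b) ++ z (κ (c / b)),
    fun c hc => hz _ _ (hB (g1 _ (hm c hc))), fun c d hcd hd' => StrictLex.lt ?_⟩
  have hc := hcd.trans hd'
  have hle : c / b ≤ d / b := by
    rw [← mul_le_iff_le_div (h0 c hc)]
    exact (Ordinal.mul_div_le c b).trans hcd.le
  rcases hle.lt_or_eq with h | h
  · have h' : κ (c / b) + 1 ≤ κ (d / b) := by
      rw [hd c hc, hd d hd'] at h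
      exact Nat.succ_le_of_lt (by exact_mod_cast h)
    obtain ⟨k, hk⟩ := Nat.exists_eq_add_of_le h'
    beta_reduce
    rw [hk, wordPow_add, wordPow_add, wordPow_one]
    simp only [List.append_assoc, strictLex_append_left]
    exact (hlt _ (g1 _ (hm c hc))).append _ _
  · have h' : c % b < d % b := by
      have h1 := Ordinal.div_add_mod c b
      have h2 := Ordinal.div_add_mod d b
      rw [← h1, ← h2, h] at hcd
      exact lt_of_add_lt_add_left hcd
    simp only [h, List.append_assoc, strictLex_append_left]
    exact ((hG.prefixFree X).strictLex (hB (g1 _ (hm c hc))) (hB (g1 _ (hm d hd')))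
      (g2 _ _ h' (hm d hd'))).append _ _

/-- A bounded production stays entirely below one power of the loop of its left-hand side, which
supplies the factor ω. -/
theorem typeGE_ruleExponent (hG : IsOrdinalGrammar G) (hN : IsNormalForm G)
    {M : Set G.NT} {U : G.NT → List T} {l : ℕ} (hU : IsLoopSystem G M U l)
    {a : G.NT → Ordinal.{0}} {r : ContextFreeRule T G.NT} (hr : r ∈ G.rules) (hM : r.input ∈ M)
    (h : ∀ Z ∈ nonterminals r.output, TypeGE (lang G Z) (ω ^ a Z)) :
    TypeGE (lang G r.input) (ω ^ ruleExponent a U r) := by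
  have hB := typeGE_formLang hG a r.output h
  have hsub : formLang G r.output ⊆ lang G r.input := fun w hw => mem_lang_iff.2 ⟨r, hr, rfl, hw⟩
  rw [ruleExponent]
  split_ifs with hb
  · cases he : nonterminals r.output with
    -- A production without nonterminals contributes exponent 0 + 1; this is attained because L(X)
    -- is infinite.
    | nil => simpa [exponent] using typeGE_omega0 hG hN r.input
    | cons Y δ =>
      have hY : Y ∈ M := hU.closed r hr hM Y (by simp [he])
      have hlen := (hU.length _ hM).trans (hU.length _ hY).symm
      obtain ⟨m, hm⟩ := (context_terminalPrefix hN.lang_nonempty hr he).strictLex_of_ne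
        (hU.loop _ hM) (hU.loop _ hY) (hU.ne_nil hM) hlen hG hN (hb Y (by simp [he]))
      rw [← he, opow_add, opow_one]
      refine typeGE_mul_omega0 hG ((hU.loop _ hM).pow m) hsub (fun w hw => ?_) hB
      obtain ⟨β, -, hβ⟩ := exists_of_nonterminals_eq_cons he
      rw [hβ, formLang_terminals_append, formLang_cons_nonterminal] at hw
      obtain ⟨_, ⟨y, hy, z, -, rfl⟩, rfl⟩ := hw
      have := (hU.loop _ hY).strictLex_of_strictLex (hU.ne_nil hY) hG hm hy
      simpa using this.append_left z
  · rw [add_zero]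
    exact hB.mono hsub le_rfl

theorem typeGE_of_reach (hG : IsOrdinalGrammar G) (hN : IsNormalForm G) {X Y : G.NT}
    (h : Reach G X Y) {o : Ordinal} (ho : TypeGE (lang G Y) o) : TypeGE (lang G X) o := by
  obtain ⟨u, hu⟩ := exists_context_of_reach hN.lang_nonempty h
  exact hu.typeGE hG ho

/-- A production `X → vYδ` where `Y` leads back to `X` and `Z` is in `δ`. -/
theorem typeGE_of_loop (hG : IsOrdinalGrammar G) (hN : IsNormalForm G)
    {r : ContextFreeRule T G.NT} (hr : r ∈ G.rules) {Y Z : G.NT} {δ : List G.NT}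
    (he : nonterminals r.output = Y :: δ) (hY : Reach G Y r.input) (hZ : Z ∈ δ) {d : Ordinal}
    (hd : TypeGE (lang G Z) (ω ^ d)) : TypeGE (lang G r.input) (ω ^ (d * ω)) := by
  have h1 := typeGE_mul_of_rule hG hN hr he hZ hd (typeGE_of_reach hG hN hY (hG.typeGE r.input))
  have h2 := h1.le (hG.typeLE r.input)
  have h3 : ω ^ d * hG.orderType r.input = hG.orderType r.input :=
    le_antisymm h2 (le_mul_of_one_le_left' (Order.one_le_iff_pos.2 (opow_pos _ omega0_pos)))
  refine (hG.typeGE r.input).mono subset_rfl ?_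
  rw [opow_mul]
  -- The fixed points of left multiplication by `ω ^ d` are the multiples of its ω-th power.
  exact le_of_dvd (orderType_pos hG hN _).ne' (mul_eq_right_iff_opow_omega0_dvd.1 h3)

end Bounds

/-! ### Ordinals below `ω ^ ω` as lists of exponents -/

section ExponentLists

open Ordinal

/-- The list `[e₁, …, eₙ]` stands for `ω ^ e₁ + ⋯ + ω ^ eₙ`. -/
noncomputable def listValue (l : List ℕ) : Ordinal.{0} :=
  (l.map fun e : ℕ => (ω : Ordinal.{0}) ^ (e : Ordinal.{0})).sum

@[simp] theorem listValue_nil : listValue [] = 0 := by simp [listValue]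

@[simp] theorem listValue_cons (e : ℕ) (l : List ℕ) :
    listValue (e :: l) = ω ^ (e : Ordinal) + listValue l := by simp [listValue]

@[simp] theorem listValue_append (l l' : List ℕ) :
    listValue (l ++ l') = listValue l + listValue l' := by simp [listValue]

theorem listValue_lt (l : List ℕ) : listValue l < ω ^ (ω : Ordinal) := by
  induction l with
  | nil => simpa using opow_pos _ omega0_pos
  | cons e l ih =>
    rw [listValue_cons]
    exact isPrincipal_add_omega0_opow ω
      ((opow_lt_opow_iff_right one_lt_omega0).2 (natCast_lt_omega0 e)) ih

theorem listValue_ne_zero {l : List ℕ} (h : l ≠ []) : listValue l ≠ 0 := by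
  cases l with
  | nil => exact absurd rfl h
  | cons e l =>
    rw [listValue_cons]
    exact ((opow_pos _ omega0_pos).trans_le le_self_add).ne'

theorem opow_le_listValue {l : List ℕ} {e : ℕ} (h : e ∈ l) : ω ^ (e : Ordinal) ≤ listValue l := by
  induction l with
  | nil => simp at h
  | cons d l ih =>
    rw [listValue_cons]
    rcases List.mem_cons.1 h with rfl | h
    · exact le_self_add
    · exact (ih h).trans le_add_self

/-- Absorption: each term on the left is a power of ω strictly below a power that `x` dominates. -/
theorem listValue_add_eq {l : List ℕ} {x : Ordinal} (h : ∀ e ∈ l, ω ^ ((e + 1 : ℕ) : Ordinal) ≤ x) :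
    listValue l + x = x := by
  induction l with
  | nil => simp
  | cons e l ih =>
    rw [listValue_cons, add_assoc, ih fun d hd => h d (by simp [hd])]
    refine add_of_omega0_opow_le ?_ (h e (by simp))
    exact (opow_lt_opow_iff_right one_lt_omega0).2 (by exact_mod_cast Nat.lt_succ_self e)

theorem listValue_replicate (n e : ℕ) : listValue (List.replicate n e) = ω ^ (e : Ordinal) * n := by
  induction n with
  | zero => simp
  | succ n ih =>
    rw [List.replicate_succ', listValue_append, ih]
    simp [mul_add_one]

theorem exists_listValue_eq (o : Ordinal.{0}) (ho : o < ω ^ (ω : Ordinal)) :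
    ∃ l, listValue l = o := by
  induction o using WellFoundedLT.induction with
  | _ o ih =>
    rcases eq_or_ne o 0 with rfl | h0
    · exact ⟨[], by simp⟩
    · obtain ⟨k, hk⟩ := lt_omega0.1 ((lt_opow_iff_log_lt one_lt_omega0 h0).1 ho)
      have hlt : o < ω ^ (Order.succ (k : Ordinal)) := hk ▸ lt_opow_succ_log_self one_lt_omega0 o
      have hle : ω ^ (k : Ordinal) ≤ o := hk ▸ opow_log_le_self _ h0
      have hp : ω ^ (k : Ordinal) ≠ 0 := (opow_pos _ omega0_pos).ne'
      rw [opow_succ, lt_mul_iff_div_lt hp] at hlt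
      obtain ⟨n, hn⟩ := lt_omega0.1 hlt
      have hm := (mod_lt o hp).trans_le hle
      obtain ⟨l, hl⟩ := ih _ hm (hm.trans ho)
      refine ⟨List.replicate n k ++ l, ?_⟩
      rw [listValue_append, listValue_replicate, hl, ← hn, div_add_mod]

/-- The Cantor normal form of `listValue l`. -/
def listNote (l : List ℕ) : ONote := l.foldr (fun e x => ONote.oadd (ONote.ofNat e) 1 0 + x) 0

instance listNote_nf (l : List ℕ) : (listNote l).NF := by
  induction l with
  | nil => exact ONote.NF.zero
  | cons e l ih =>
    have : (ONote.oadd (ONote.ofNat e) 1 0).NF := ONote.NF.oadd_zero _ _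
    have h : listNote (e :: l) = ONote.oadd (ONote.ofNat e) 1 0 + listNote l := rfl
    rw [h]
    infer_instance

theorem repr_listNote (l : List ℕ) : (listNote l).repr = listValue l := by
  induction l with
  | nil => simp [listNote]
  | cons e l ih =>
    have : (ONote.oadd (ONote.ofNat e) 1 0).NF := ONote.NF.oadd_zero _ _
    have h : listNote (e :: l) = ONote.oadd (ONote.ofNat e) 1 0 + listNote l := rfl
    rw [h, ONote.repr_add, ih]
    simp

theorem listNote_eq_iff {l l' : List ℕ} : listNote l = listNote l' ↔ listValue l = listValue l' := by
  rw [← ONote.repr_inj, repr_listNote, repr_listNote]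

/-- The code of a natural number as an ordinal notation. -/
def natNoteCode (e : ℕ) : ℕ := if e = 0 then 0 else Nat.pair 0 (Nat.pair (e - 1) 0) + 1

/-- Adding `ω ^ e` on the left, on codes. -/
def addPowerCode (e m : ℕ) : ℕ :=
  if m = 0 then Nat.pair (natNoteCode e) 0 + 1
  else if natNoteCode e < (m - 1).unpair.1 then m
  else if natNoteCode e = (m - 1).unpair.1 then
    Nat.pair (natNoteCode e)
      (Nat.pair ((m - 1).unpair.2.unpair.1 + 1) (m - 1).unpair.2.unpair.2) + 1
  else Nat.pair (natNoteCode e) (Nat.pair 0 m) + 1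

def listNoteCode (l : List ℕ) : ℕ := l.foldr addPowerCode 0

theorem onoteToNat_ofNat_nat (e : ℕ) : onoteToNat (ONote.ofNat e) = natNoteCode e := by
  cases e with
  | zero => rfl
  | succ e =>
    simp [ONote.ofNat_succ, onoteToNat, natNoteCode]

/-- Allows exponents to be compared through their codes, so that `addPowerCode` needs only numerical
comparisons. -/
theorem natNoteCode_strictMono : StrictMono natNoteCode := by
  intro a b h
  unfold natNoteCode
  rw [if_neg (by omega : b ≠ 0)]
  split_ifs with ha
  · exact Nat.succ_pos _
  · have := Nat.pair_lt_pair_right 0 (Nat.pair_lt_pair_left 0 (by omega : a - 1 < b - 1))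
    omega

/-- The second part keeps the induction going: the leading exponent is always a natural number, so
comparing notations agrees with comparing codes. -/
theorem onoteToNat_listNote (l : List ℕ) : onoteToNat (listNote l) = listNoteCode l ∧
    (listNote l = 0 ∨ ∃ k n a, listNote l = ONote.oadd (ONote.ofNat k) n a) := by
  induction l with
  | nil => exact ⟨rfl, Or.inl rfl⟩
  | cons e l ih =>
    have h : listNote (e :: l) = ONote.addAux (ONote.ofNat e) 1 (0 + listNote l) := rfl
    have h' : listNoteCode (e :: l) = addPowerCode e (listNoteCode l) := rfl
    have h0 : (0 : ONote) + listNote l = listNote l := rfl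
    rw [h0] at h
    rw [h, h', ← ih.1]
    rcases ih.2 with h1 | ⟨k, n, a, h1⟩
    · rw [h1]
      refine ⟨?_, Or.inr ⟨e, 1, 0, rfl⟩⟩
      simp only [ONote.addAux, onoteToNat, onoteToNat_ofNat_nat, addPowerCode]
      rfl
    · have hc := ONote.cmp_compares (ONote.ofNat e) (ONote.ofNat k)
      rw [h1]
      simp only [ONote.addAux, onoteToNat, addPowerCode, Nat.add_eq_zero_iff, one_ne_zero,
        and_false, if_false, Nat.add_sub_cancel, Nat.unpair_pair, onoteToNat_ofNat_nat]
      cases hcmp : (ONote.ofNat e).cmp (ONote.ofNat k) with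
      | lt =>
        rw [hcmp] at hc
        have hlt : e < k := by
          have : ONote.ofNat e < ONote.ofNat k := hc
          rw [ONote.lt_def] at this
          simpa using this
        rw [if_pos (natNoteCode_strictMono hlt)]
        exact ⟨by simp [onoteToNat, onoteToNat_ofNat_nat], Or.inr ⟨k, n, a, rfl⟩⟩
      | eq =>
        rw [hcmp] at hc
        have heq : e = k := by
          have : ONote.ofNat e = ONote.ofNat k := hc
          rw [← ONote.repr_inj] at this
          simpa using this
        subst heq
        rw [if_neg (lt_irrefl _), if_pos rfl]
        refine ⟨?_, Or.inr ⟨e, 1 + n, a, rfl⟩⟩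
        simp only [onoteToNat, onoteToNat_ofNat_nat]
        have : (1 + n).natPred = n.natPred + 1 := by
          have := n.natPred_add_one
          have h2 := (1 + n).natPred_add_one
          simp only [PNat.add_coe, PNat.one_coe] at h2
          omega
        rw [this]
      | gt =>
        rw [hcmp] at hc
        have hlt : k < e := by
          have : ONote.ofNat k < ONote.ofNat e := hc
          rw [ONote.lt_def] at this
          simpa using this
        have := natNoteCode_strictMono hlt
        rw [if_neg this.asymm, if_neg this.ne']
        refine ⟨?_, Or.inr ⟨e, 1, _, rfl⟩⟩
        have h2 : (1 : ℕ+).natPred = 0 := rfl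
        simp [onoteToNat, onoteToNat_ofNat_nat, h2]

theorem primrec_natNoteCode : Primrec natNoteCode :=
  Primrec.ite (Primrec.eq.comp .id (.const 0)) (.const 0)
    (Primrec.succ.comp (Primrec₂.natPair.comp (.const 0)
      (Primrec₂.natPair.comp Primrec.pred (.const 0))))

theorem primrec_addPowerCode : Primrec₂ addPowerCode := by
  have he : Primrec fun p : ℕ × ℕ => natNoteCode p.1 := primrec_natNoteCode.comp .fst
  have hu : Primrec fun p : ℕ × ℕ => (p.2 - 1).unpair :=
    Primrec.unpair.comp (Primrec.pred.comp .snd)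
  have hu2 : Primrec fun p : ℕ × ℕ => (p.2 - 1).unpair.2.unpair :=
    Primrec.unpair.comp (Primrec.snd.comp hu)
  refine Primrec.ite (Primrec.eq.comp .snd (.const 0))
    (Primrec.succ.comp (Primrec₂.natPair.comp he (.const 0))) ?_
  refine Primrec.ite (Primrec.nat_lt.comp he (Primrec.fst.comp hu)) .snd ?_
  refine Primrec.ite (Primrec.eq.comp he (Primrec.fst.comp hu)) ?_ ?_
  · exact Primrec.succ.comp (Primrec₂.natPair.comp he (Primrec₂.natPair.comp
      (Primrec.succ.comp (Primrec.fst.comp hu2)) (Primrec.snd.comp hu2)))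
  · exact Primrec.succ.comp (Primrec₂.natPair.comp he (Primrec₂.natPair.comp (.const 0) .snd))

theorem primrec_listNoteCode : Primrec listNoteCode :=
  Primrec.list_foldr (h := fun _ p => addPowerCode p.1 p.2) .id (.const 0)
    (primrec_addPowerCode.comp (Primrec.fst.comp .snd) (Primrec.snd.comp .snd))

/-- Normal forms are unique, so equality of the ordinals denoted by two lists becomes a decidable
equality of numbers. -/
theorem listNoteCode_eq_iff {l l' : List ℕ} :
    listNoteCode l = listNoteCode l' ↔ listValue l = listValue l' := by
  rw [← listNote_eq_iff, ← (onoteToNat_listNote l).1, ← (onoteToNat_listNote l').1]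
  exact onoteEquivNat.injective.eq_iff

/-- The Cantor normal form of `ω ^ listValue l`. -/
def powerNote (l : List ℕ) : ONote := ONote.oadd (listNote l) 1 0

theorem powerNote_nf (l : List ℕ) : (powerNote l).NF := ONote.NF.oadd_zero _ _

theorem repr_powerNote (l : List ℕ) : (powerNote l).repr = ω ^ listValue l := by
  simp [powerNote, repr_listNote]

theorem primrec_powerNote : Primrec powerNote := by
  have h : Primrec fun l => onoteToNat (powerNote l) := by
    refine Primrec.of_eq (Primrec.succ.comp (Primrec₂.natPair.comp primrec_listNoteCode
      (.const (Nat.pair (1 : ℕ+).natPred (onoteToNat 0))))) fun l => ?_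
    simp [powerNote, onoteToNat, (onoteToNat_listNote l).1]
  exact (Primrec.of_equiv_iff onoteEquivNat).1 h

end ExponentLists

/-! ### Certificates for the exponents of order types -/

/-- The nonterminals of a coded sentential form. -/
def codeNonterminals (w : List (ℕ ⊕ ℕ)) : List ℕ := w.filterMap Sum.getLeft?

/-- The terminal prefix of a coded sentential form. -/
def codeTerminalPrefix (w : List (ℕ ⊕ ℕ)) : List ℕ :=
  (w.takeWhile Sum.isRight).filterMap Sum.getRight?

/-- A set of nonterminals; a loop, an exponent and a rank for each of them; a list of paths
`(X, u, Y)` such that `X` derives a sentential form beginning with `uY`; and a list of exponents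
that may be used as differences. -/
abbrev Certificate : Type :=
  List ℕ × List (List ℕ) × List (List ℕ) × List ℕ × List (ℕ × List ℕ × ℕ) × List (List ℕ)

namespace Certificate

def domain (C : Certificate) : List ℕ := C.1
def loop (C : Certificate) (X : ℕ) : List ℕ := C.2.1.getD X []
def expo (C : Certificate) (X : ℕ) : List ℕ := C.2.2.1.getD X []
def order (C : Certificate) (X : ℕ) : ℕ := C.2.2.2.1.getD X 0
def paths (C : Certificate) : List (ℕ × List ℕ × ℕ) := C.2.2.2.2.1
def slack (C : Certificate) : List (List ℕ) := C.2.2.2.2.2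

/-- The exponent contributed by a production. -/
def ruleList (C : Certificate) (p : ℕ × List (ℕ ⊕ ℕ)) : List ℕ :=
  -- Exponents add up from right to left, and `[0]` denotes the extra summand ω⁰ = 1 of a bounded
  -- production.
  (codeNonterminals p.2).reverse.flatMap C.expo ++
    if codeNonterminals p.2 ≠ [] ∧ C.loop p.1 ++ codeTerminalPrefix p.2 =
      codeTerminalPrefix p.2 ++ C.loop (codeNonterminals p.2).headI then [] else [0]

def LoopValid (C : Certificate) (x X : ℕ) : Prop :=
  (C.loop X).length = (C.loop x).length ∧ C.loop X ≠ [] ∧ C.expo X ≠ [] ∧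
    (X, C.loop X, X) ∈ C.paths

/-- The inequality between exponents is witnessed by an explicit difference `ε`, turning it into an
equality of codes. -/
def UpperValid (C : Certificate) (p : ℕ × List (ℕ ⊕ ℕ)) : Prop :=
  (∀ Z ∈ codeNonterminals p.2, Z ∈ C.domain) ∧
    ∃ ε ∈ C.slack, listNoteCode (C.ruleList p ++ ε) = listNoteCode (C.expo p.1)

/-- The two ways of attaining an exponent: through a production over strictly lower nonterminals, or
through a leading nonterminal that leads back. In the second case a tail nonterminal whose exponent
d contains ω^e gives d·ω ≥ ω^(e+1). -/
def LowerValid (C : Certificate) (X : ℕ) (p : ℕ × List (ℕ ⊕ ℕ)) : Prop :=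
  (C.expo X = C.ruleList p ∧ ∀ Z ∈ codeNonterminals p.2, C.order Z < C.order X) ∨
    ∃ Z ∈ (codeNonterminals p.2).tail, C.order Z < C.order X ∧
      (∃ f ∈ C.paths, (codeNonterminals p.2).head? = some f.1 ∧ f.2.2 = p.1) ∧
      ∃ e ∈ C.expo Z, C.expo X = [e + 1]

end Certificate

/-- A path is trivial, or it starts with a production and continues with another path. -/
def PathValid (R : List (ℕ × List (ℕ ⊕ ℕ))) (F : List (ℕ × List ℕ × ℕ)) (f : ℕ × List ℕ × ℕ) :
    Prop :=
  (f.2.1 = [] ∧ f.1 = f.2.2) ∨ ∃ p ∈ R, p.1 = f.1 ∧ ∃ f' ∈ F, f'.2.2 = f.2.2 ∧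
    (codeNonterminals p.2).head? = some f'.1 ∧ f.2.1 = codeTerminalPrefix p.2 ++ f'.2.1

structure Certificate.Valid (R : List (ℕ × List (ℕ ⊕ ℕ))) (x : ℕ) (C : Certificate) : Prop where
  mem : x ∈ C.domain
  loops : ∀ X ∈ C.domain, C.LoopValid x X
  paths : ∀ f ∈ C.paths, PathValid R C.paths f
  upper : ∀ p ∈ R, p.1 ∈ C.domain → C.UpperValid p
  lower : ∀ X ∈ C.domain, C.expo X = [0] ∨
    ∃ f ∈ C.paths, f.1 = X ∧ ∃ p ∈ R, p.1 = f.2.2 ∧ C.LowerValid X p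

/-! ### Coded productions and productions of the grammar -/

section Translation

variable {T N : Type} (eN : N → ℕ) (eT : T → ℕ)

theorem codeNonterminals_map (α : List (Symbol T N)) :
    codeNonterminals (α.map (codeSymbol eN eT)) = (nonterminals α).map eN := by
  induction α with
  | nil => rfl
  | cons s α ih =>
    cases s with
    | terminal a =>
      simp only [nonterminals]
      rw [← ih]
      exact List.filterMap_cons_none rfl
    | nonterminal X =>
      simp only [nonterminals, List.map_cons]
      rw [← ih]
      simp [codeNonterminals, codeSymbol]

theorem codeTerminalPrefix_map (α : List (Symbol T N)) :
    codeTerminalPrefix (α.map (codeSymbol eN eT)) = (terminalPrefix α).map eT := by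
  induction α with
  | nil => rfl
  | cons s α ih =>
    cases s with
    | terminal a =>
      simp only [terminalPrefix, List.map_cons]
      rw [← ih]
      rfl
    | nonterminal X => simp [codeTerminalPrefix, codeSymbol, terminalPrefix]

theorem codeNonterminals_codeRule (r : ContextFreeRule T N) :
    codeNonterminals (codeRule eN eT r).2 = (nonterminals r.output).map eN :=
  codeNonterminals_map eN eT _

theorem codeTerminalPrefix_codeRule (r : ContextFreeRule T N) :
    codeTerminalPrefix (codeRule eN eT r).2 = (terminalPrefix r.output).map eT :=
  codeTerminalPrefix_map eN eT _

open Ordinal in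
theorem exponent_eq_listValue (g : ℕ → List ℕ) (δ : List N) :
    exponent (fun X => listValue (g (eN X))) δ =
      listValue ((δ.map eN).reverse.flatMap g) := by
  induction δ with
  | nil => simp [exponent]
  | cons Y δ ih => simp [exponent, ih]

open Classical in
theorem Certificate.ruleList_codeRule (heT : Function.Injective eT) (C : Certificate)
    (U : N → List T) (r : ContextFreeRule T N)
    (h1 : (U r.input).map eT = C.loop (eN r.input))
    (h2 : ∀ Z ∈ nonterminals r.output, (U Z).map eT = C.loop (eN Z)) :
    C.ruleList (codeRule eN eT r) = ((nonterminals r.output).map eN).reverse.flatMap C.expo ++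
      if IsBounded U r then [0] else [] := by
  unfold Certificate.ruleList
  rw [codeNonterminals_codeRule, codeTerminalPrefix_codeRule]
  congr 1
  have hi : (codeRule eN eT r).1 = eN r.input := rfl
  cases he : nonterminals r.output with
  | nil => simp [IsBounded, he]
  | cons Y δ =>
    have hiff : C.loop (eN r.input) ++ (terminalPrefix r.output).map eT =
        (terminalPrefix r.output).map eT ++ C.loop (eN Y) ↔
        U r.input ++ terminalPrefix r.output = terminalPrefix r.output ++ U Y := by
      rw [← h1, ← h2 Y (by simp [he]), ← List.map_append, ← List.map_append]
      exact (List.map_injective_iff.2 heT).eq_iff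
    rw [hi]
    simp only [List.map_cons, ne_eq, reduceCtorEq, not_false_eq_true, true_and, List.headI_cons,
      hiff, IsBounded, he, List.head?_cons, Option.mem_def, Option.some.injEq, forall_eq']
    split_ifs <;> simp_all

end Translation

/-! ### Soundness of certificates -/

section Soundness

open Ordinal

variable {T : Type} [LinearOrder T] {G : ContextFreeGrammar T} {eN : G.NT → ℕ} {eT : T → ℕ}
  {c : GrammarCode} {C : Certificate} {x : ℕ}

/-- Listed paths justify one another. The justification is not circular, because each production
contributes a nonempty terminal prefix and so the remaining word is shorter. -/
theorem exists_path_of_valid (hN : IsNormalForm G) (hc : IsCode G eN eT c)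
    (hC : ∀ f ∈ C.paths, PathValid c.2.2.1 C.paths f) :
    ∀ n, ∀ f ∈ C.paths, f.2.1.length = n → ∀ X, f.1 = eN X →
      ∃ Y w, f.2.2 = eN Y ∧ w.map eT = f.2.1 ∧ Context G X w Y ∧ Reach G X Y := by
  intro n
  induction n using Nat.strong_induction_on with
  | _ n ih =>
  rintro f hf rfl X hX
  rcases hC f hf with ⟨h1, h2⟩ | ⟨p, hp, h1, f', hf', h2, h3, h4⟩
  · exact ⟨X, [], h2 ▸ hX, by simp [h1], .refl X, .refl⟩
  · obtain ⟨r, hr, rfl⟩ := (hc.productions p).1 hp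
    rw [codeNonterminals_codeRule] at h3
    rw [codeTerminalPrefix_codeRule] at h4
    have hX' : r.input = X := hc.injective (h1.trans hX)
    subst hX'
    cases he : nonterminals r.output with
    | nil => simp [he] at h3
    | cons Z δ =>
      simp only [he, List.map_cons, List.head?_cons, Option.some.injEq] at h3
      have hlt : f'.2.1.length < f.2.1.length := by
        rw [h4]
        simpa using List.length_pos_iff.2 (hN.terminalPrefix_ne_nil hr)
      obtain ⟨Y, w, e1, e2, e3, e4⟩ := ih _ hlt f' hf' rfl Z h3.symm
      refine ⟨Y, terminalPrefix r.output ++ w, h2 ▸ e1, by simp [h4, e2],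
        (context_terminalPrefix hN.lang_nonempty hr he).trans e3, e4.head ⟨r, hr, rfl, by simp [he]⟩⟩

/-- A valid certificate contains the order type. -/
theorem Certificate.Valid.orderType_eq [Finite G.NT] (hG : IsOrdinalGrammar G)
    (hN : IsNormalForm G) (hc : IsCode G eN eT c) {X : G.NT} (hC : C.Valid c.2.2.1 (eN X)) :
    hG.orderType X = ω ^ listValue (C.expo (eN X)) := by
  classical
  have hpath := exists_path_of_valid hN hc hC.paths
  let M : Set G.NT := {Y | eN Y ∈ C.domain}
  have hloop : ∀ Y, ∃ w : List T, Y ∈ M → w.map eT = C.loop (eN Y) ∧ Context G Y w Y := by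
    intro Y
    by_cases hY : Y ∈ M
    · obtain ⟨Y', w, e1, e2, e3, -⟩ := hpath _ _ (hC.loops _ hY).2.2.2 rfl Y rfl
      obtain rfl := hc.injective e1
      exact ⟨w, fun _ => ⟨e2, e3⟩⟩
    · exact ⟨[], fun h => absurd h hY⟩
  choose U hU using hloop
  have hsys : IsLoopSystem G M U (C.loop (eN X)).length := by
    refine ⟨fun r hr hM Z hZ => ?_, List.length_pos_iff.2 (hC.loops _ hC.mem).2.1, fun Y hY => ?_,
      fun Y hY => (hU Y hY).2⟩
    · refine (hC.upper _ ((hc.productions _).2 ⟨r, hr, rfl⟩) hM).1 (eN Z) ?_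
      rw [codeNonterminals_codeRule]
      exact List.mem_map_of_mem hZ
    · rw [← (hC.loops _ hY).1, ← (hU Y hY).1, List.length_map]
  have hreach : ∀ {Y Z}, Reach G Y Z → Y ∈ M → Z ∈ M := by
    intro Y Z h hY
    induction h with
    | refl => exact hY
    | tail _ hs ih =>
      obtain ⟨r, hr, rfl, hZ⟩ := hs
      exact hsys.closed r hr ih _ hZ
  let a : G.NT → Ordinal := fun Y => listValue (C.expo (eN Y))
  have hrule : ∀ r ∈ G.rules, r.input ∈ M →
      ruleExponent a U r = listValue (C.ruleList (codeRule eN eT r)) := by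
    intro r hr hM
    rw [C.ruleList_codeRule eN eT hc.strictMono.injective U r (hU _ hM).1
      fun Z hZ => (hU _ (hsys.closed r hr hM Z hZ)).1, ruleExponent, exponent_eq_listValue,
      listValue_append]
    congr 1
    split_ifs <;> simp
  have hupper := typeLE_lang_of_ruleExponent_le hG hN hsys (a := a)
    (fun Y hY => listValue_ne_zero (hC.loops _ hY).2.2.1) fun r hr hM => by
      obtain ⟨ε, -, h⟩ := (hC.upper _ ((hc.productions _).2 ⟨r, hr, rfl⟩) hM).2
      rw [listNoteCode_eq_iff, listValue_append, ← hrule r hr hM] at h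
      exact le_self_add.trans_eq h
  -- The recorded ranks make the lower bounds well-founded; they need not agree with the true ranks
  -- of the grammar.
  have hlower : ∀ n, ∀ Y ∈ M, C.order (eN Y) = n → TypeGE (lang G Y) (ω ^ a Y) := by
    intro n
    induction n using Nat.strong_induction_on with
    | _ n ih =>
    rintro Y hY rfl
    rcases hC.lower _ hY with h | ⟨f, hf, h1, p, hp, h2, h⟩
    · have : a Y = 1 := by simp [a, h]
      rw [this, opow_one]
      exact typeGE_omega0 hG hN Y
    · obtain ⟨r, hr, rfl⟩ := (hc.productions p).1 hp
      obtain ⟨Y', w, e1, -, -, e4⟩ := hpath _ f hf rfl Y h1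
      obtain rfl : r.input = Y' := hc.injective (h2.trans e1)
      have hM := hreach e4 hY
      refine typeGE_of_reach hG hN e4 ?_
      rcases h with ⟨h3, h4⟩ | ⟨Z, hZ, h4, ⟨f', hf', h5, h6⟩, e, he, h7⟩
      · have : a Y = ruleExponent a U r := by rw [hrule r hr hM, ← h3]
        rw [this]
        refine typeGE_ruleExponent hG hN hsys hr hM fun Z hZ => ?_
        refine ih _ (h4 (eN Z) ?_) Z (hsys.closed r hr hM Z hZ) rfl
        rw [codeNonterminals_codeRule]
        exact List.mem_map_of_mem hZ
      · rw [codeNonterminals_codeRule] at hZ h5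
        cases hnt : nonterminals r.output with
        | nil => simp [hnt] at hZ
        | cons V δ =>
          simp only [hnt, List.map_cons, List.tail_cons, List.mem_map] at hZ
          simp only [hnt, List.map_cons, List.head?_cons, Option.some.injEq] at h5
          obtain ⟨Z, hZ, rfl⟩ := hZ
          obtain ⟨W, w', e5, -, -, e6⟩ := hpath _ f' hf' rfl V h5.symm
          obtain rfl : r.input = W := hc.injective (h6.symm.trans e5)
          have hZM := hsys.closed r hr hM Z (by simp [hnt, hZ])
          refine (typeGE_of_loop hG hN hr hnt e6 hZ (ih _ h4 Z hZM rfl)).mono subset_rfl ?_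
          refine opow_le_opow_right omega0_pos ?_
          have : a Y = ω ^ (e : Ordinal) * ω := by simp [a, h7, opow_add]
          rw [this]
          gcongr
          exact opow_le_listValue he
  exact le_antisymm ((hG.typeGE X).le (hupper X hC.mem))
    ((hlower _ X hC.mem rfl).le (hG.typeLE X))

end Soundness

/-! ### Existence of certificates -/

/-! ### Paths through leading nonterminals -/

section Paths

theorem PathValid.mono {R : List (ℕ × List (ℕ ⊕ ℕ))} {F F' : List (ℕ × List ℕ × ℕ)}
    {f : ℕ × List ℕ × ℕ} (h : PathValid R F f) (hF : ∀ f ∈ F, f ∈ F') : PathValid R F' f := by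
  rcases h with h | ⟨p, hp, h1, f', hf', h2⟩
  · exact Or.inl h
  · exact Or.inr ⟨p, hp, h1, f', hF _ hf', h2⟩

variable {T : Type} {G : ContextFreeGrammar T}

/-- `X` derives a sentential form beginning with `uY`, expanding leading nonterminals only. -/
inductive Path (G : ContextFreeGrammar T) : G.NT → List T → G.NT → Prop
  | nil (X : G.NT) : Path G X [] X
  | cons {r : ContextFreeRule T G.NT} (hr : r ∈ G.rules) {Y Z : G.NT} {δ : List G.NT}
      (he : nonterminals r.output = Y :: δ) {u : List T} (h : Path G Y u Z) :
      Path G r.input (terminalPrefix r.output ++ u) Z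

theorem Path.trans {X Y Z : G.NT} {u v : List T} (h : Path G X u Y) (h' : Path G Y v Z) :
    Path G X (u ++ v) Z := by
  induction h with
  | nil => exact h'
  | cons hr he _ ih =>
    rw [List.append_assoc]
    exact .cons hr he (ih h')

theorem Path.pow {X : G.NT} {u : List T} (h : Path G X u X) (n : ℕ) :
    Path G X (wordPow u n) X := by
  induction n with
  | zero => exact .nil X
  | succ n ih => exact h.trans ih

theorem Path.context {X Y : G.NT} {u : List T} (h : Path G X u Y)
    (hne : ∀ X : G.NT, (lang G X).Nonempty) : Context G X u Y := by
  induction h with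
  | nil X => exact .refl X
  | cons hr he _ ih => exact (context_terminalPrefix hne hr he).trans ih

/-- Every nonterminal occurring in a production is recursive, the start symbol included: whatever
calls it is reachable from it. The recursive nonterminals are therefore closed under the
productions. -/
theorem transGen_calls_of_calls (hN : IsNormalForm G) {X Y : G.NT} (h : Calls G X Y) :
    Relation.TransGen (Calls G) Y Y := by
  by_cases hY : Y = G.initial
  · obtain ⟨u, v, hd⟩ := (hN.usable X).1
    have : Reach G Y X := by
      rw [hY]
      exact reach_of_derives hd (by simp)
    exact Relation.TransGen.tail' this h
  · exact transGen_calls_of_isRecursive (hN.recursive Y hY)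

variable [LinearOrder T]

/-- A call that can be undone must concern the leading nonterminal, so it can be followed by a path.
-/
theorem exists_path_of_reach (hG : IsOrdinalGrammar G) (hN : IsNormalForm G) {X Y : G.NT}
    (h : Reach G X Y) (h' : Reach G Y X) : ∃ u, Path G X u Y := by
  induction h using Relation.ReflTransGen.head_induction_on with
  | refl => exact ⟨[], .nil Y⟩
  | head hs hr ih =>
    obtain ⟨u, hu⟩ := ih (h'.tail hs)
    obtain ⟨r, hr', rfl, hc⟩ := hs
    cases he : nonterminals r.output with
    | nil => simp [he] at hc
    | cons Z δ =>
      rw [he] at hc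
      rcases List.mem_cons.1 hc with rfl | hc
      · exact ⟨_, .cons hr' he hu⟩
      · exact absurd (hr.trans h') (not_reach_of_mem_tail hG hN hr' he hc)

theorem exists_loop (hG : IsOrdinalGrammar G) (hN : IsNormalForm G) {X : G.NT}
    (h : Relation.TransGen (Calls G) X X) : ∃ u, u ≠ [] ∧ Path G X u X := by
  obtain ⟨Y, ⟨r, hr, rfl, hY⟩, h⟩ := Relation.TransGen.head'_iff.1 h
  cases he : nonterminals r.output with
  | nil => simp [he] at hY
  | cons Z δ =>
    rw [he] at hY
    rcases List.mem_cons.1 hY with rfl | hY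
    · obtain ⟨u, hu⟩ := exists_path_of_reach hG hN h (.single ⟨r, hr, rfl, by simp [he]⟩)
      exact ⟨_, by simp [hN.terminalPrefix_ne_nil hr], .cons hr he hu⟩
    · exact absurd h (not_reach_of_mem_tail hG hN hr he hY)

theorem exists_loops_of_common_length [Finite G.NT] (hG : IsOrdinalGrammar G)
    (hN : IsNormalForm G) : ∃ (U : G.NT → List T) (l : ℕ), 0 < l ∧
      ∀ X, Relation.TransGen (Calls G) X X → (U X).length = l ∧ Path G X (U X) X := by
  classical
  have := Fintype.ofFinite G.NT
  have h : ∀ X, ∃ u : List T, Relation.TransGen (Calls G) X X → u ≠ [] ∧ Path G X u X := by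
    intro X
    by_cases hX : Relation.TransGen (Calls G) X X
    · obtain ⟨u, hu⟩ := exists_loop hG hN hX
      exact ⟨u, fun _ => hu⟩
    · exact ⟨[], fun h => absurd h hX⟩
  choose u hu using h
  let s := Finset.univ.filter fun X => Relation.TransGen (Calls G) X X
  have hpos : ∀ X ∈ s, 0 < (u X).length := fun X hX =>
    List.length_pos_iff.2 (hu X (Finset.mem_filter.1 hX).2).1
  -- The product of all loop lengths is a common multiple; each loop is repeated until it reaches
  -- that length.
  refine ⟨fun X => wordPow (u X) ((∏ Y ∈ s, (u Y).length) / (u X).length),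
    ∏ Y ∈ s, (u Y).length, Finset.prod_pos hpos, fun X hX => ⟨?_, (hu X hX).2.pow _⟩⟩
  rw [length_wordPow]
  exact Nat.div_mul_cancel (Finset.dvd_prod_of_mem _ (Finset.mem_filter.2 ⟨Finset.mem_univ _, hX⟩))

variable {eN : G.NT → ℕ} {eT : T → ℕ} {c : GrammarCode}

theorem Path.exists_valid (hc : IsCode G eN eT c) {X Y : G.NT} {u : List T} (h : Path G X u Y) :
    ∃ F : List (ℕ × List ℕ × ℕ), (∀ f ∈ F, PathValid c.2.2.1 F f) ∧
      (eN X, u.map eT, eN Y) ∈ F := by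
  induction h with
  | nil X =>
    refine ⟨[(eN X, [], eN X)], ?_, by simp⟩
    intro f hf
    rw [List.mem_singleton.1 hf]
    exact Or.inl ⟨rfl, rfl⟩
  | @cons r hr Y Z δ he u _ ih =>
    obtain ⟨F, hF, hmem⟩ := ih
    refine ⟨(eN r.input, (terminalPrefix r.output ++ u).map eT, eN Z) :: F, ?_, by simp⟩
    intro f hf
    rcases List.mem_cons.1 hf with rfl | hf
    · refine Or.inr ⟨codeRule eN eT r, (hc.productions _).2 ⟨r, hr, rfl⟩, rfl, _,
        List.mem_cons_of_mem _ hmem, rfl, ?_, ?_⟩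
      · simp [codeNonterminals_codeRule, he]
      · simp [codeTerminalPrefix_codeRule]
    · exact (hF f hf).mono fun f' hf' => List.mem_cons_of_mem _ hf'

theorem exists_valid_paths (hc : IsCode G eN eT c) {S : Set (G.NT × List T × G.NT)}
    (hfin : S.Finite) (hS : ∀ s ∈ S, Path G s.1 s.2.1 s.2.2) :
    ∃ F : List (ℕ × List ℕ × ℕ), (∀ f ∈ F, PathValid c.2.2.1 F f) ∧
      ∀ s ∈ S, (eN s.1, s.2.1.map eT, eN s.2.2) ∈ F := by
  induction S, hfin using Set.Finite.induction_on with
  | empty => exact ⟨[], by simp, by simp⟩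
  | @insert s S _ _ ih =>
    obtain ⟨F, hF, hmem⟩ := ih fun s' hs' => hS s' (by simp [hs'])
    obtain ⟨F', hF', hmem'⟩ := (hS s (by simp)).exists_valid hc
    refine ⟨F' ++ F, fun f hf => ?_, fun s' hs' => ?_⟩
    · rcases List.mem_append.1 hf with hf | hf
      · exact (hF' f hf).mono fun f' hf' => List.mem_append_left _ hf'
      · exact (hF f hf).mono fun f' hf' => List.mem_append_right _ hf'
    · rcases Set.mem_insert_iff.1 hs' with rfl | hs'
      · exact List.mem_append_left _ hmem'
      · exact List.mem_append_right _ (hmem s' hs')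

end Paths

/-! ### Maximal candidate exponents -/

section Exponents

open Ordinal

variable {T : Type} {G : ContextFreeGrammar T}

open Classical in
/-- The exponent contributed by a production, as a list. -/
noncomputable def ruleExponents {N : Type} (U : N → List T) (g : N → List ℕ)
    (r : ContextFreeRule T N) : List ℕ :=
  (nonterminals r.output).reverse.flatMap g ++ if IsBounded U r then [0] else []

/-- The possible exponents of `X`, given the exponents `g` of the nonterminals of lower rank. -/
def candidates (G : ContextFreeGrammar T) (U : G.NT → List T) (g : G.NT → List ℕ) (X : G.NT) :
    Set (List ℕ) :=
  {l | l = [0] ∨ ∃ r ∈ G.rules, Reach G X r.input ∧ Reach G r.input X ∧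
    ((l = ruleExponents U g r ∧ ∀ Z ∈ nonterminals r.output, rank G Z < rank G X) ∨
      ∃ Y δ, nonterminals r.output = Y :: δ ∧ Reach G Y r.input ∧
        ∃ Z ∈ δ, rank G Z < rank G X ∧ ∃ e ∈ g Z, l = [e + 1])}

theorem candidates_subset (U : G.NT → List T) {g g' : G.NT → List ℕ} {X : G.NT}
    (h : ∀ Z, rank G Z < rank G X → g Z = g' Z) : candidates G U g X ⊆ candidates G U g' X := by
  rintro l (hl | ⟨r, hr, h1, h2, ⟨rfl, h3⟩ | ⟨Y, δ, h3, h4, Z, hZ, h5, e, he, rfl⟩⟩)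
  · exact Or.inl hl
  · refine Or.inr ⟨r, hr, h1, h2, Or.inl ⟨?_, h3⟩⟩
    unfold ruleExponents
    congr 1
    refine List.flatMap_congr fun Z hZ => h Z (h3 Z (List.mem_reverse.1 hZ))
  · exact Or.inr ⟨r, hr, h1, h2, Or.inr ⟨Y, δ, h3, h4, Z, hZ, h5, e, h Z h5 ▸ he, rfl⟩⟩

theorem candidates_congr (U : G.NT → List T) {g g' : G.NT → List ℕ} {X : G.NT}
    (h : ∀ Z, rank G Z < rank G X → g Z = g' Z) : candidates G U g X = candidates G U g' X :=
  (candidates_subset U h).antisymm (candidates_subset U fun Z hZ => (h Z hZ).symm)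

theorem candidates_eq_of_reach [Finite G.NT] (U : G.NT → List T) (g : G.NT → List ℕ) {X Y : G.NT}
    (h : Reach G X Y) (h' : Reach G Y X) : candidates G U g X = candidates G U g Y := by
  have hr : rank G X = rank G Y := le_antisymm (rank_le_of_reach h') (rank_le_of_reach h)
  ext l
  simp only [candidates, Set.mem_ofPred_eq, hr]
  refine or_congr Iff.rfl (exists_congr fun r => and_congr_right fun _ => ?_)
  exact ⟨fun ⟨h1, h2, h3⟩ => ⟨h'.trans h1, h2.trans h, h3⟩,
    fun ⟨h1, h2, h3⟩ => ⟨h.trans h1, h2.trans h', h3⟩⟩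

theorem candidates_finite (U : G.NT → List T) (g : G.NT → List ℕ) (X : G.NT) :
    (candidates G U g X).Finite := by
  refine Set.Finite.subset (s := {[0]} ∪ ⋃ r ∈ (G.rules : Set (ContextFreeRule T G.NT)),
    ({ruleExponents U g r} ∪ ⋃ Z ∈ {Z | Z ∈ nonterminals r.output}, ⋃ e ∈ {e | e ∈ g Z},
      {[e + 1]})) ?_ ?_
  · exact (Set.finite_singleton _).union (G.rules.finite_toSet.biUnion fun r _ =>
      (Set.finite_singleton _).union ((List.finite_toSet _).biUnion fun Z _ =>
        (List.finite_toSet _).biUnion fun e _ => Set.finite_singleton _))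
  · rintro l (rfl | ⟨r, hr, h1, h2, ⟨rfl, h3⟩ | ⟨Y, δ, h3, h4, Z, hZ, h5, e, he, rfl⟩⟩)
    · exact Or.inl rfl
    · exact Or.inr (Set.mem_biUnion hr (Or.inl rfl))
    · refine Or.inr (Set.mem_biUnion hr (Or.inr ?_))
      have hZ' : Z ∈ {Z | Z ∈ nonterminals r.output} := by
        change Z ∈ nonterminals r.output
        simp [h3, hZ]
      exact Set.mem_biUnion hZ' (Set.mem_biUnion (show e ∈ {e | e ∈ g Z} from he) rfl)

/-- The candidates for `X` depend only on exponents at smaller rank and are finite in number, so a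
maximal one can be chosen by recursion on the rank. The choice depends only on the candidate set,
which mutually reachable nonterminals share; hence they receive the same list. -/
theorem exists_exponents [Finite G.NT] (U : G.NT → List T) :
    ∃ g : G.NT → List ℕ, (∀ X, g X ∈ candidates G U g X) ∧
      (∀ X, ∀ l ∈ candidates G U g X, listValue l ≤ listValue (g X)) ∧
      ∀ X Y, Reach G X Y → Reach G Y X → g X = g Y := by
  classical
  have hmax : ∀ S : Set (List ℕ), ∃ l, S.Finite → S.Nonempty →
      l ∈ S ∧ ∀ l' ∈ S, listValue l' ≤ listValue l := by
    intro S
    by_cases hS : S.Finite ∧ S.Nonempty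
    · obtain ⟨l, hl, hmax⟩ := Set.exists_max_image S listValue hS.1 hS.2
      exact ⟨l, fun _ _ => ⟨hl, hmax⟩⟩
    · exact ⟨[], fun h1 h2 => absurd ⟨h1, h2⟩ hS⟩
  choose pick hpick using hmax
  have hrec : ∀ n, ∃ g : G.NT → List ℕ, ∀ X, rank G X < n → g X = pick (candidates G U g X) := by
    intro n
    induction n with
    | zero => exact ⟨fun _ => [], fun X h => absurd h (Nat.not_lt_zero _)⟩
    | succ n ih =>
      obtain ⟨g, hg⟩ := ih
      refine ⟨fun X => if rank G X = n then pick (candidates G U g X) else g X, fun X hX => ?_⟩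
      rw [candidates_congr (g' := g) U fun Z hZ => if_neg (by omega)]
      beta_reduce
      split_ifs with h
      · rfl
      · exact hg X (by omega)
  obtain ⟨g, hg⟩ := hrec (Nat.card G.NT + 1)
  have hg' : ∀ X, g X = pick (candidates G U g X) := fun X =>
    hg X (Nat.lt_succ_of_le (Set.ncard_le_card _))
  have hne : ∀ X, (candidates G U g X).Nonempty := fun X => ⟨[0], Or.inl rfl⟩
  have hp := fun X => hpick _ (candidates_finite U g X) (hne X)
  refine ⟨g, fun X => ?_, fun X => ?_, fun X Y h h' => ?_⟩
  · exact (hg' X).symm ▸ (hp X).1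
  · rw [hg' X]
    exact (hp X).2
  · rw [hg' X, hg' Y, candidates_eq_of_reach U g h h']

variable [LinearOrder T]

/-- Maximality makes the chosen exponents solve the upper-bound inequalities. A production over
lower ranks is itself a candidate. Otherwise its leading nonterminal is equivalent to the left-hand
side, the production is not bounded, and the exponents of the tail are absorbed. -/
theorem listValue_ruleExponents_le [Finite G.NT] (hG : IsOrdinalGrammar G) (hN : IsNormalForm G)
    {M : Set G.NT} {U : G.NT → List T} {l : ℕ} (hU : IsLoopSystem G M U l) {g : G.NT → List ℕ}
    (hmax : ∀ X, ∀ l ∈ candidates G U g X, listValue l ≤ listValue (g X))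
    (heq : ∀ X Y, Reach G X Y → Reach G Y X → g X = g Y) {r : ContextFreeRule T G.NT}
    (hr : r ∈ G.rules) (hM : r.input ∈ M) :
    listValue (ruleExponents U g r) ≤ listValue (g r.input) := by
  by_cases h : ∀ Z ∈ nonterminals r.output, rank G Z < rank G r.input
  · exact hmax _ _ (Or.inr ⟨r, hr, .refl, .refl, Or.inl ⟨rfl, h⟩⟩)
  · cases he : nonterminals r.output with
    | nil => simp [he] at h
    | cons Y δ =>
      have hδ : ∀ Z ∈ δ, rank G Z < rank G r.input := fun Z hZ =>
        rank_lt_of_mem_tail hG hN hr he hZ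
      have hY : rank G r.input ≤ rank G Y := by
        by_contra! hY
        refine h fun Z hZ => ?_
        rw [he] at hZ
        rcases List.mem_cons.1 hZ with rfl | hZ
        · exact hY
        · exact hδ Z hZ
      have hXY : Reach G r.input Y := .single ⟨r, hr, rfl, by simp [he]⟩
      have hYX := reach_of_rank_eq hXY hY
      have hb : ¬ IsBounded U r := fun hb =>
        absurd (rank_lt_of_isBounded hG hN hU hr hM he hb) (not_lt.2 hY)
      rw [ruleExponents, if_neg hb, List.append_nil, he, List.reverse_cons, List.flatMap_append,
        listValue_append, List.flatMap_singleton, heq Y _ hYX hXY]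
      -- For each term ω^e of a tail exponent, `[e + 1]` is a candidate, so ω^(e+1) is at most the
      -- chosen exponent.
      refine (listValue_add_eq fun e hmem => ?_).le
      obtain ⟨Z, hZ, hmem⟩ := List.mem_flatMap.1 hmem
      rw [List.mem_reverse] at hZ
      have := hmax r.input [e + 1] (Or.inr ⟨r, hr, .refl, .refl, Or.inr
        ⟨Y, δ, he, hYX, Z, hZ, hδ Z hZ, e, hmem, rfl⟩⟩)
      simpa using this

end Exponents

/-! ### Finite functions and sets as lists -/

section Encoding

theorem exists_list_getD_eq {ι α : Type} [Finite ι] {e : ι → ℕ} (he : Function.Injective e)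
    (f : ι → α) (d : α) : ∃ L : List α, ∀ i, L.getD (e i) d = f i := by
  classical
  obtain ⟨B, hB⟩ := (Set.finite_range e).bddAbove
  refine ⟨(List.range (B + 1)).map (Function.extend e f fun _ => d), fun i => ?_⟩
  have : e i < B + 1 := Nat.lt_succ_of_le (hB ⟨i, rfl⟩)
  simp [List.getD_eq_getElem?_getD, List.getElem?_map, List.getElem?_range this, he.extend_apply]

theorem exists_list_mem_iff {α : Type} {S : Set α} (hS : S.Finite) :
    ∃ L : List α, ∀ a, a ∈ L ↔ a ∈ S :=
  ⟨hS.toFinset.toList, fun a => by simp⟩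

end Encoding

/-! ### Completeness of certificates -/

section Completeness

open Ordinal

variable {T : Type} [LinearOrder T] {G : ContextFreeGrammar T} {eN : G.NT → ℕ} {eT : T → ℕ}
  {c : GrammarCode}

theorem Certificate.exists_valid [Finite G.NT] (hG : IsOrdinalGrammar G) (hN : IsNormalForm G)
    (hc : IsCode G eN eT c) {X : G.NT} (hX : IsRecursive G X) :
    ∃ C : Certificate, C.Valid c.2.2.1 (eN X) := by
  classical
  obtain ⟨U, l, hl, hU⟩ := exists_loops_of_common_length hG hN
  obtain ⟨g, hg, hmax, heq⟩ := exists_exponents U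
  let M : Set G.NT := {Y | Relation.TransGen (Calls G) Y Y}
  have hXM : X ∈ M := transGen_calls_of_isRecursive hX
  have hsys : IsLoopSystem G M U l :=
    ⟨fun r hr _ Z hZ => transGen_calls_of_calls hN ⟨r, hr, rfl, hZ⟩, hl,
      fun Y hY => (hU Y hY).1, fun Y hY => (hU Y hY).2.context hN.lang_nonempty⟩
  obtain ⟨L₁, hL₁⟩ := exists_list_mem_iff ((Set.toFinite M).image eN)
  obtain ⟨L₂, hL₂⟩ := exists_list_getD_eq hc.injective (fun Y => (U Y).map eT) []
  obtain ⟨L₃, hL₃⟩ := exists_list_getD_eq hc.injective g []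
  obtain ⟨L₄, hL₄⟩ := exists_list_getD_eq hc.injective (rank G) 0
  have hW : ∀ p : G.NT × G.NT, ∃ u, Reach G p.1 p.2 → Reach G p.2 p.1 → Path G p.1 u p.2 := by
    intro p
    by_cases hp : Reach G p.1 p.2 ∧ Reach G p.2 p.1
    · obtain ⟨u, hu⟩ := exists_path_of_reach hG hN hp.1 hp.2
      exact ⟨u, fun _ _ => hu⟩
    · exact ⟨[], fun h1 h2 => absurd ⟨h1, h2⟩ hp⟩
  choose W hW using hW
  obtain ⟨F, hF, hFmem⟩ := exists_valid_paths hc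
    (S := (fun Y => (Y, U Y, Y)) '' M ∪
      (fun p : G.NT × G.NT => (p.1, W p, p.2)) '' {p | Reach G p.1 p.2 ∧ Reach G p.2 p.1})
    (((Set.toFinite _).image _).union ((Set.toFinite _).image _)) (by
      rintro s (⟨Y, hY, rfl⟩ | ⟨p, hp, rfl⟩)
      · exact (hU Y hY).2
      · exact hW p hp.1 hp.2)
  have hε : ∀ r : ContextFreeRule T G.NT, ∃ ε, r ∈ G.rules → r.input ∈ M →
      listValue (ruleExponents U g r ++ ε) = listValue (g r.input) := by
    intro r
    by_cases hr : r ∈ G.rules ∧ r.input ∈ M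
    · have hle := listValue_ruleExponents_le hG hN hsys hmax heq hr.1 hr.2
      -- The difference of the two exponents is below ω^ω and is therefore the value of a list.
      obtain ⟨ε, hε⟩ := exists_listValue_eq
        (listValue (g r.input) - listValue (ruleExponents U g r))
        ((sub_le_self _ _).trans_lt (listValue_lt _))
      refine ⟨ε, fun _ _ => ?_⟩
      rw [listValue_append, hε, Ordinal.add_sub_cancel_of_le hle]
    · exact ⟨[], fun h1 h2 => absurd ⟨h1, h2⟩ hr⟩
  choose ε hε using hε
  obtain ⟨E, hE⟩ := exists_list_mem_iff (G.rules.finite_toSet.image ε)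
  let C : Certificate := (L₁, L₂, L₃, L₄, F, E)
  have hdom : ∀ Y, eN Y ∈ C.domain ↔ Y ∈ M := fun Y =>
    (hL₁ _).trans hc.injective.mem_set_image
  have hloop : ∀ Y, C.loop (eN Y) = (U Y).map eT := hL₂
  have hexpo : ∀ Y, C.expo (eN Y) = g Y := hL₃
  have horder : ∀ Y, C.order (eN Y) = rank G Y := hL₄
  have hdom' : ∀ m ∈ C.domain, ∃ Y ∈ M, eN Y = m := fun m hm => (hL₁ m).1 hm
  have hrule : ∀ r : ContextFreeRule T G.NT,
      C.ruleList (codeRule eN eT r) = ruleExponents U g r := by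
    intro r
    rw [C.ruleList_codeRule eN eT hc.strictMono.injective U r (hloop _).symm
      fun Z _ => (hloop Z).symm, ruleExponents, ← List.map_reverse, List.flatMap_map]
    simp only [hexpo]
  refine ⟨C, (hdom X).2 hXM, ?_, hF, ?_, ?_⟩
  · intro m hm
    obtain ⟨Y, hY, rfl⟩ := hdom' m hm
    refine ⟨?_, ?_, ?_, ?_⟩
    · simp [hloop, (hU Y hY).1, (hU X hXM).1]
    · simpa [hloop] using hsys.ne_nil hY
    · rw [hexpo]
      intro h
      have := hmax Y [0] (Or.inl rfl)
      simp [h] at this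
    · rw [hloop]
      exact hFmem _ (Or.inl ⟨Y, hY, rfl⟩)
  · intro p hp hM
    obtain ⟨r, hr, rfl⟩ := (hc.productions p).1 hp
    have hM' := (hdom _).1 hM
    refine ⟨?_, ε r, (hE _).2 ⟨r, hr, rfl⟩, ?_⟩
    · intro m hm
      rw [codeNonterminals_codeRule] at hm
      obtain ⟨Z, hZ, rfl⟩ := List.mem_map.1 hm
      exact (hdom Z).2 (hsys.closed r hr hM' Z hZ)
    · rw [listNoteCode_eq_iff, hrule, hε r hr hM']
      exact congrArg listValue (hexpo r.input).symm
  · intro m hm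
    obtain ⟨Y, hY, rfl⟩ := hdom' m hm
    rw [hexpo]
    rcases hg Y with h | ⟨r, hr, h1, h2, h3⟩
    · exact Or.inl h
    · refine Or.inr ⟨_, hFmem _ (Or.inr ⟨(Y, r.input), ⟨h1, h2⟩, rfl⟩), rfl, codeRule eN eT r,
        (hc.productions _).2 ⟨r, hr, rfl⟩, rfl, ?_⟩
      rcases h3 with ⟨h3, h4⟩ | ⟨V, δ, h3, h4, Z, hZ, h5, e, he, h6⟩
      · refine Or.inl ⟨by rw [hexpo, hrule, h3], fun n hn => ?_⟩
        rw [codeNonterminals_codeRule] at hn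
        obtain ⟨Z, hZ, rfl⟩ := List.mem_map.1 hn
        rw [horder, horder]
        exact h4 Z hZ
      · refine Or.inr ⟨eN Z, ?_, by rwa [horder, horder], ⟨_, hFmem _ (Or.inr ⟨(V, r.input),
          ⟨h4, .single ⟨r, hr, rfl, by simp [h3]⟩⟩, rfl⟩), ?_, rfl⟩, e, by rwa [hexpo], by
            rw [hexpo, h6]⟩
        · simp only [codeNonterminals_codeRule, h3, List.map_cons, List.tail_cons]
          exact List.mem_map_of_mem hZ
        · simp [codeNonterminals_codeRule, h3]

end Completeness

/-! ### Computability -/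

section Computability

variable {α β : Type} [Primcodable α] [Primcodable β]

theorem primrecPred_forall_mem {f : α → List β} {R : α → β → Prop} (hf : Primrec f)
    (hR : PrimrecPred fun p : α × β => R p.1 p.2) : PrimrecPred fun a => ∀ b ∈ f a, R a b := by
  have h : PrimrecRel fun (b : β) (a : α) => R a b :=
    hR.comp (Primrec.pair Primrec.snd Primrec.fst)
  exact h.forall_mem_list.comp hf .id

theorem primrecPred_exists_mem {f : α → List β} {R : α → β → Prop} (hf : Primrec f)
    (hR : PrimrecPred fun p : α × β => R p.1 p.2) : PrimrecPred fun a => ∃ b ∈ f a, R a b := by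
  have h : PrimrecRel fun (b : β) (a : α) => R a b :=
    hR.comp (Primrec.pair Primrec.snd Primrec.fst)
  exact h.exists_mem_list.comp hf .id

theorem primrecPred_mem {f : α → List β} {g : α → β} (hf : Primrec f) (hg : Primrec g) :
    PrimrecPred fun a => g a ∈ f a :=
  (primrecPred_exists_mem hf (R := fun a b => b = g a)
    (Primrec.eq.comp .snd (hg.comp .fst))).of_eq fun a => by simp

theorem primrec_codeNonterminals : Primrec codeNonterminals := by
  have h : Primrec (Sum.getLeft? : ℕ ⊕ ℕ → Option ℕ) :=
    (Primrec.sumCasesOn .id (g := fun _ b => some b) (h := fun _ _ => none)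
      (Primrec.option_some.comp .snd) (Primrec.const none)).of_eq fun p => by cases p <;> rfl
  exact Primrec.listFilterMap .id (h.comp .snd)

theorem primrec_codeTerminalPrefix : Primrec codeTerminalPrefix := by
  have h : Primrec (Sum.isRight : ℕ ⊕ ℕ → Bool) :=
    (Primrec.sumCasesOn .id (g := fun _ _ => false) (h := fun _ _ => true)
      (Primrec.const false) (Primrec.const true)).of_eq fun p => by cases p <;> rfl
  have h' : Primrec (Sum.getRight? : ℕ ⊕ ℕ → Option ℕ) :=
    (Primrec.sumCasesOn .id (g := fun _ _ => none) (h := fun _ b => some b)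
      (Primrec.const none) (Primrec.option_some.comp .snd)).of_eq fun p => by cases p <;> rfl
  exact Primrec.listFilterMap (Primrec.list_takeWhile h) (h'.comp .snd)

variable {C : α → Certificate} {X : α → ℕ} {p : α → ℕ × List (ℕ ⊕ ℕ)}

theorem primrec_domain (hC : Primrec C) : Primrec fun a => (C a).domain := Primrec.fst.comp hC

theorem primrec_loop (hC : Primrec C) (hX : Primrec X) : Primrec fun a => (C a).loop (X a) :=
  (Primrec.list_getD []).comp (Primrec.fst.comp (Primrec.snd.comp hC)) hX

theorem primrec_expo (hC : Primrec C) (hX : Primrec X) : Primrec fun a => (C a).expo (X a) :=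
  (Primrec.list_getD []).comp (Primrec.fst.comp (Primrec.snd.comp (Primrec.snd.comp hC))) hX

theorem primrec_order (hC : Primrec C) (hX : Primrec X) : Primrec fun a => (C a).order (X a) :=
  (Primrec.list_getD 0).comp
    (Primrec.fst.comp (Primrec.snd.comp (Primrec.snd.comp (Primrec.snd.comp hC)))) hX

theorem primrec_paths (hC : Primrec C) : Primrec fun a => (C a).paths :=
  Primrec.fst.comp (Primrec.snd.comp (Primrec.snd.comp (Primrec.snd.comp (Primrec.snd.comp hC))))

theorem primrec_slack (hC : Primrec C) : Primrec fun a => (C a).slack :=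
  Primrec.snd.comp (Primrec.snd.comp (Primrec.snd.comp (Primrec.snd.comp (Primrec.snd.comp hC))))

theorem primrec_ruleList (hC : Primrec C) (hp : Primrec p) :
    Primrec fun a => (C a).ruleList (p a) := by
  have hn : Primrec fun a => codeNonterminals (p a).2 :=
    primrec_codeNonterminals.comp (Primrec.snd.comp hp)
  have ht : Primrec fun a => codeTerminalPrefix (p a).2 :=
    primrec_codeTerminalPrefix.comp (Primrec.snd.comp hp)
  refine Primrec.list_append.comp
    (Primrec.list_flatMap (Primrec.list_reverse.comp hn) (primrec_expo (hC.comp .fst) .snd))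
    (Primrec.ite (PrimrecPred.and (PrimrecPred.not (Primrec.eq.comp hn (.const []))) ?_)
      (.const []) (.const [0]))
  exact Primrec.eq.comp
    (Primrec.list_append.comp (primrec_loop hC (Primrec.fst.comp hp)) ht)
    (Primrec.list_append.comp ht (primrec_loop hC (Primrec.list_headI.comp hn)))

theorem primrecPred_loopValid {x : α → ℕ} (hC : Primrec C) (hx : Primrec x) (hX : Primrec X) :
    PrimrecPred fun a => (C a).LoopValid (x a) (X a) := by
  refine PrimrecPred.and (Primrec.eq.comp (Primrec.list_length.comp (primrec_loop hC hX))
    (Primrec.list_length.comp (primrec_loop hC hx))) ?_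
  refine PrimrecPred.and (PrimrecPred.not (Primrec.eq.comp (primrec_loop hC hX) (.const []))) ?_
  refine PrimrecPred.and (PrimrecPred.not (Primrec.eq.comp (primrec_expo hC hX) (.const []))) ?_
  exact primrecPred_mem (primrec_paths hC) (Primrec.pair hX (Primrec.pair (primrec_loop hC hX) hX))

theorem primrecPred_upperValid (hC : Primrec C) (hp : Primrec p) :
    PrimrecPred fun a => (C a).UpperValid (p a) := by
  refine PrimrecPred.and (primrecPred_forall_mem
    (primrec_codeNonterminals.comp (Primrec.snd.comp hp))
    (primrecPred_mem (primrec_domain (hC.comp .fst)) .snd)) ?_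
  refine primrecPred_exists_mem (primrec_slack hC) (Primrec.eq.comp
    (primrec_listNoteCode.comp (Primrec.list_append.comp ?_ .snd))
    (primrec_listNoteCode.comp ?_))
  · exact primrec_ruleList (hC.comp .fst) (hp.comp .fst)
  · exact primrec_expo (hC.comp .fst) (Primrec.fst.comp (hp.comp .fst))

theorem primrecPred_lowerValid (hC : Primrec C) (hX : Primrec X) (hp : Primrec p) :
    PrimrecPred fun a => (C a).LowerValid (X a) (p a) := by
  have hn : Primrec fun a => codeNonterminals (p a).2 :=
    primrec_codeNonterminals.comp (Primrec.snd.comp hp)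
  have hlt : PrimrecPred fun q : α × ℕ => (C q.1).order q.2 < (C q.1).order (X q.1) :=
    Primrec.nat_lt.comp (primrec_order (hC.comp .fst) .snd)
      (primrec_order (hC.comp .fst) (hX.comp .fst))
  refine PrimrecPred.or (PrimrecPred.and
    (Primrec.eq.comp (primrec_expo hC hX) (primrec_ruleList hC hp))
    (primrecPred_forall_mem hn hlt)) ?_
  refine primrecPred_exists_mem (Primrec.list_tail.comp hn) (PrimrecPred.and hlt
    (PrimrecPred.and ?_ ?_))
  · refine primrecPred_exists_mem (primrec_paths (hC.comp .fst)) (PrimrecPred.and ?_ ?_)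
    · exact Primrec.eq.comp (Primrec.list_head?.comp (hn.comp (Primrec.fst.comp .fst)))
        (Primrec.option_some.comp (Primrec.fst.comp .snd))
    · exact Primrec.eq.comp (Primrec.snd.comp (Primrec.snd.comp .snd))
        (Primrec.fst.comp (hp.comp (Primrec.fst.comp .fst)))
  · refine primrecPred_exists_mem (primrec_expo (hC.comp .fst) .snd) ?_
    exact Primrec.eq.comp
      (primrec_expo (hC.comp (Primrec.fst.comp .fst)) (hX.comp (Primrec.fst.comp .fst)))
      (Primrec.list_cons.comp (Primrec.succ.comp .snd) (.const []))

theorem primrecPred_pathValid {R : α → List (ℕ × List (ℕ ⊕ ℕ))} {F : α → List (ℕ × List ℕ × ℕ)}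
    {f : α → ℕ × List ℕ × ℕ} (hR : Primrec R) (hF : Primrec F) (hf : Primrec f) :
    PrimrecPred fun a => PathValid (R a) (F a) (f a) := by
  refine PrimrecPred.or (PrimrecPred.and
    (Primrec.eq.comp (Primrec.fst.comp (Primrec.snd.comp hf)) (.const []))
    (Primrec.eq.comp (Primrec.fst.comp hf) (Primrec.snd.comp (Primrec.snd.comp hf)))) ?_
  refine primrecPred_exists_mem hR (PrimrecPred.and
    (Primrec.eq.comp (Primrec.fst.comp .snd) (Primrec.fst.comp (hf.comp .fst))) ?_)
  refine primrecPred_exists_mem (hF.comp .fst) ?_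
  have hf' := hf.comp (Primrec.fst.comp (Primrec.fst (α := α × (ℕ × List (ℕ ⊕ ℕ)))
    (β := ℕ × List ℕ × ℕ)))
  have hw : Primrec fun q : (α × (ℕ × List (ℕ ⊕ ℕ))) × (ℕ × List ℕ × ℕ) => q.1.2.2 :=
    Primrec.snd.comp (Primrec.snd.comp .fst)
  refine PrimrecPred.and (Primrec.eq.comp (Primrec.snd.comp (Primrec.snd.comp .snd))
    (Primrec.snd.comp (Primrec.snd.comp hf'))) (PrimrecPred.and ?_ ?_)
  · exact Primrec.eq.comp (Primrec.list_head?.comp (primrec_codeNonterminals.comp hw))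
      (Primrec.option_some.comp (Primrec.fst.comp .snd))
  · exact Primrec.eq.comp (Primrec.fst.comp (Primrec.snd.comp hf'))
      (Primrec.list_append.comp (primrec_codeTerminalPrefix.comp hw)
        (Primrec.fst.comp (Primrec.snd.comp .snd)))

theorem primrecPred_valid {R : α → List (ℕ × List (ℕ ⊕ ℕ))} {x : α → ℕ} (hR : Primrec R)
    (hx : Primrec x) (hC : Primrec C) : PrimrecPred fun a => (C a).Valid (R a) (x a) := by
  have h1 : PrimrecPred fun a => ∀ X ∈ (C a).domain, (C a).LoopValid (x a) X :=
    primrecPred_forall_mem (primrec_domain hC)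
      (primrecPred_loopValid (hC.comp .fst) (hx.comp .fst) .snd)
  have h2 : PrimrecPred fun a => ∀ f ∈ (C a).paths, PathValid (R a) (C a).paths f :=
    primrecPred_forall_mem (primrec_paths hC)
      (primrecPred_pathValid (hR.comp .fst) (primrec_paths (hC.comp .fst)) .snd)
  -- The implication is rewritten as a disjunction to fit the closure properties of primitive
  -- recursive predicates.
  have h3 : PrimrecPred fun a => ∀ p ∈ R a, ¬ p.1 ∈ (C a).domain ∨ (C a).UpperValid p :=
    primrecPred_forall_mem hR (PrimrecPred.or (PrimrecPred.not
      (primrecPred_mem (primrec_domain (hC.comp .fst)) (Primrec.fst.comp .snd)))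
      (primrecPred_upperValid (hC.comp .fst) .snd))
  have h4 : PrimrecPred fun a => ∀ X ∈ (C a).domain, (C a).expo X = [0] ∨
      ∃ f ∈ (C a).paths, f.1 = X ∧ ∃ p ∈ R a, p.1 = f.2.2 ∧ (C a).LowerValid X p := by
    refine primrecPred_forall_mem (primrec_domain hC) (PrimrecPred.or
      (Primrec.eq.comp (primrec_expo (hC.comp .fst) .snd) (.const [0])) ?_)
    refine primrecPred_exists_mem (primrec_paths (hC.comp .fst)) (PrimrecPred.and
      (Primrec.eq.comp (Primrec.fst.comp .snd) (Primrec.snd.comp .fst)) ?_)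
    refine primrecPred_exists_mem (hR.comp (Primrec.fst.comp .fst)) (PrimrecPred.and
      (Primrec.eq.comp (Primrec.fst.comp .snd)
        (Primrec.snd.comp (Primrec.snd.comp (Primrec.snd.comp .fst)))) ?_)
    exact primrecPred_lowerValid (hC.comp (Primrec.fst.comp (Primrec.fst.comp .fst)))
      (Primrec.snd.comp (Primrec.fst.comp .fst)) .snd
  refine (((((primrecPred_mem (primrec_domain hC) hx).and h1).and h2).and h3).and h4).of_eq
    fun a => ?_
  constructor
  · rintro ⟨⟨⟨⟨h0, h1⟩, h2⟩, h3⟩, h4⟩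
    exact ⟨h0, h1, h2, fun p hp hm => (h3 p hp).resolve_left (not_not.2 hm), h4⟩
  · rintro ⟨h0, h1, h2, h3, h4⟩
    exact ⟨⟨⟨⟨h0, h1⟩, h2⟩, fun p hp => or_iff_not_imp_left.2 fun hm => h3 p hp (not_not.1 hm)⟩, h4⟩

end Computability

open Classical in
/-- The normal form read off from the certificate with number `n`, if it is valid. -/
noncomputable def certifiedNote (q : GrammarCode × ℕ) (n : ℕ) : Option ONote :=
  (Encodable.decode (α := Certificate) n).bind fun C =>
    if C.Valid q.1.2.2.1 q.2 then some (powerNote (C.expo q.2)) else none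

theorem primrec_certifiedNote : Primrec₂ certifiedNote := by
  classical
  refine Primrec.option_bind (Primrec.decode.comp .snd) ?_
  have hq : Primrec fun a : ((GrammarCode × ℕ) × ℕ) × Certificate => a.1.1 :=
    Primrec.fst.comp .fst
  refine Primrec.ite (primrecPred_valid
      (Primrec.fst.comp (Primrec.snd.comp (Primrec.snd.comp (Primrec.fst.comp hq))))
      (Primrec.snd.comp hq) .snd) ?_ (.const none)
  exact Primrec.option_some.comp (primrec_powerNote.comp (primrec_expo .snd (Primrec.snd.comp hq)))

end OrdinalGrammar

theorem mainTheorem4 :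
    ∃ A : OrdinalGrammar.GrammarCode × ℕ →. ONote, Partrec A ∧
      ∀ (T : Type) [LinearOrder T] [Finite T] (G : ContextFreeGrammar T) [Finite G.NT]
        (hG : OrdinalGrammar.IsOrdinalGrammar G), OrdinalGrammar.IsNormalForm G →
        ∀ X : G.NT, OrdinalGrammar.IsRecursive G X →
        ∀ (eN : G.NT → ℕ) (eT : T → ℕ) (c : OrdinalGrammar.GrammarCode),
          OrdinalGrammar.IsCode G eN eT c →
          ∃ o ∈ A (c, eN X), o.NF ∧ o.repr = hG.orderType X := by
  open OrdinalGrammar in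
  -- Unbounded search through all numbers; completeness of certificates gives termination, and
  -- soundness makes whichever certificate is found correct.
  refine ⟨fun q => Nat.rfindOpt (certifiedNote q), Partrec.rfindOpt primrec_certifiedNote.to_comp,
    fun T _ _ G _ hG hN X hX eN eT c hc => ?_⟩
  obtain ⟨C, hC⟩ := Certificate.exists_valid hG hN hc hX
  have hdom : (Nat.rfindOpt (certifiedNote (c, eN X))).Dom :=
    Nat.rfindOpt_dom.2 ⟨Encodable.encode C, powerNote (C.expo (eN X)), by
      rw [certifiedNote, Encodable.encodek, Option.bind_some, if_pos hC]
      rfl⟩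
  refine ⟨_, Part.get_mem hdom, ?_⟩
  obtain ⟨n, hn⟩ := Nat.rfindOpt_spec (Part.get_mem hdom)
  simp only [certifiedNote, Option.mem_def, Option.bind_eq_some_iff, Option.ite_none_right_eq_some,
    Option.some.injEq] at hn
  obtain ⟨C', -, hC', h⟩ := hn
  rw [← h]
  exact ⟨powerNote_nf _, by rw [repr_powerNote, hC'.orderType_eq hG hN hc]⟩
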